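/- **Games.** Let $I=[a,b]$ be a finite non-empty interval of natural numbers and let $G=(V_E\sqcup V_A,E,L)$ be a parity game of index $I$: a directed graph with countably many vertices, each with at least one successor, with edge labels $L:E\to I$, in which Eve moves from the vertices of $V_E$ and Adam from those of $V_A$. A sequence of priorities is *accepting* if its limit superior is even, and Eve wins a play if its sequence of labels is accepting. Let $W\subseteq V$ be the set of initial vertices. A strategy $\sigma$ of Eve induces the graph $G_\sigma$: its vertices are the finite plays from vertices of $W$ consistent with $\sigma$, and its edges are the one-move extensions, labelled by the priority of that move. **Attractor decompositions.** For a set $X$ of edges (or vertices) of a graph $\Gamma$, $\mathrm{attr}(X,\Gamma)$ is the set of vertices from which every infinite path of $\Gamma$ meets $X$, together with $X$ itself when $X$ is a set of vertices. Let $d$ be even and let $\Gamma$ be a graph with vertex set $U$ and priorities at most $d$. Let $H$ be its set of edges of priority $d$ and $A_0=\mathrm{attr}(H,\Gamma)$. An attractor decomposition of $\Gamma$ of level $d$ consists of a family $(S_i,A_i,D_i)_{0<i<\ell}$ indexed by ordinals (empty if $d=0$) such that $U=\bigcup_{i<\ell}A_i$ and, with $U_i=U\setminus\bigcup_{j<i}A_j$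 and $\Gamma_i=(\Gamma\setminus H)|_{U_i}$, for every $0<i<\ell$: $S_i\subseteq U_i$ is non-empty and closed under successors in $\Gamma_i$; $(\Gamma\setminus H)|_{S_i}$ has no terminal vertex and only priorities at most $d-2$; $A_i=\mathrm{attr}(S_i,\Gamma_i)$; and $D_i$ is an attractor decomposition of $(\Gamma\setminus H)|_{S_i}$ of level $d-2$. Its *tree-shape* is the ordered tree whose root has as children the tree-shapes of the $D_i$ (a leaf if there are none). **Strahler number.** The $n$-Strahler number of a leaf is $1$. For another node, let $m$ be the maximum of the $n$-Strahler numbers of its children; its $n$-Strahler number is $m+1$ if at least $n+1$ children have $n$-Strahler number $m$, and $m$ otherwise. The game $G$ *has $n$-Strahler number $h$* if Eve has a strategy $\sigma$, winning from every vertex of $W$, such that $G_\sigma$ has an attractor decomposition of some even level $d\le b+1$ whose tree-shape has $n$-Strahler number $h$. **Transduction game.** For $J=[1,2h]$, $h\geq 1$, and $N\in\mathbb N$, the game $\mathrm{Reg}^{N}_{J}(G)$ has registers $r_0,\dots,r_h$ with values in $I$, initially the largest even element of $I$, and counters $c_{i,j}\in[0,N]$ for odd $i\in I$ and $0\le j\le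 h$, initially $0$. In each round: 1. the owner of the current vertex chooses an outgoing edge $e$, which is followed; 2. Eve chooses a register $r_j$; 3. an output $w$ is produced: if $j=0$, $w=1$; otherwise, if $r_j$ is even, $w=2j$; otherwise, if $c_{r_j,j}<N$, $w=2j$ and $c_{r_j,j}$ is increased by $1$; otherwise $w=2j+1$ and $c_{r_j,j}$ is reset to $0$, and Eve loses instantly if $2j+1\notin J$; 4. if $L(e)$ is even let $i=L(e)$, otherwise Eve chooses an odd $i\in I$ with $i\ge L(e)$; 5. $c_{i',j}:=0$ for all $i'<i$ and $c_{r_j,j'}:=0$ for all $j'<j$, where $r_j$ is still the old value; then $r_j:=i$ and $r_{j'}:=\max(i,r_{j'})$ for all $j'>j$. Eve wins a play if she never loses instantly and the sequence of outputs is accepting. **Statement.** Let $n\ge 1$. If $G$ has $n$-Strahler number $h$, then Eve wins $\mathrm{Reg}^{\,n+1}_{[1,2h]}(G)$ from every initial vertex in $W$. -/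

import Mathlib

open Filter

universe u

/-! ## Parity condition, parity graphs, attractors -/

/-- An infinite sequence of priorities is accepting when its limit superior (the largest value that
occurs infinitely often, all later values being at most that value) is an even number. -/
def ParityAccepting (c : ℕ → ℕ) : Prop :=
  ∃ m : ℕ, Even m ∧ (∃ᶠ k in atTop, c k = m) ∧ ∀ᶠ k in atTop, c k ≤ m

/-- A directed graph with vertex set `verts` (inside the type `X`) and edges labelled by
priorities. The values of `label` outside of the edges are irrelevant. -/
structure ParityGraph (X : Type u) where
  verts : Set X
  Adj : X → X → Prop
  adj_mem : ∀ {x y : X}, Adj x y → x ∈ verts ∧ y ∈ verts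
  label : X → X → ℕ

namespace ParityGraph

variable {X : Type u}

/-- The subgraph restricted to the vertices in `S`. -/
def restrict (G : ParityGraph X) (S : Set X) : ParityGraph X where
  verts := G.verts ∩ S
  Adj x y := G.Adj x y ∧ x ∈ S ∧ y ∈ S
  adj_mem h := ⟨⟨(G.adj_mem h.1).1, h.2.1⟩, ⟨(G.adj_mem h.1).2, h.2.2⟩⟩
  label := G.label

/-- The edges of priority `p`. -/
def edgesOf (G : ParityGraph X) (p : ℕ) (x y : X) : Prop :=
  G.Adj x y ∧ G.label x y = p

/-- The graph without its edges of priority `p`. -/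
def deletePriority (G : ParityGraph X) (p : ℕ) : ParityGraph X where
  verts := G.verts
  Adj x y := G.Adj x y ∧ G.label x y ≠ p
  adj_mem h := G.adj_mem h.1
  label := G.label

/-- `ρ` is an infinite path of `G` that starts in `x`. -/
def IsPathFrom (G : ParityGraph X) (x : X) (ρ : ℕ → X) : Prop :=
  ρ 0 = x ∧ ∀ k, G.Adj (ρ k) (ρ (k + 1))

/-- The attractor of a set of edges: the vertices from which all infinite paths have an edge
in that set. -/
def attrEdges (G : ParityGraph X) (F : X → X → Prop) : Set X :=
  {x ∈ G.verts | ∀ ρ, G.IsPathFrom x ρ → ∃ k, F (ρ k) (ρ (k + 1))}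

/-- The attractor of a set of vertices: the vertices from which all infinite paths visit that
set; the vertices of the set itself belong to it. -/
def attrVerts (G : ParityGraph X) (S : Set X) : Set X :=
  {x ∈ G.verts | x ∈ S ∨ ∀ ρ, G.IsPathFrom x ρ → ∃ k, ρ k ∈ S}

/-- All edges have priority at most `p`. -/
def PrioritiesLE (G : ParityGraph X) (p : ℕ) : Prop :=
  ∀ x y, G.Adj x y → G.label x y ≤ p

/-- No vertex is terminal. -/
def NoTerminal (G : ParityGraph X) : Prop :=
  ∀ x ∈ G.verts, ∃ y, G.Adj x y

/-- In a decomposition of `G` with top priority `p` and attractors `A k`: the vertices left when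
the attractor `A₀` of the edges of priority `p` and all earlier attractors are removed. -/
def remaining {K : Type u} [LinearOrder K] (G : ParityGraph X) (p : ℕ) (A : K → Set X) (k : K) :
    Set X :=
  G.verts \ (G.attrEdges (G.edgesOf p) ∪ ⋃ j : {j : K // j < k}, A j)

/-- The graph `Gₖ`: no edges of priority `p`, restricted to the remaining vertices. -/
def remainingGraph {K : Type u} [LinearOrder K] (G : ParityGraph X) (p : ℕ) (A : K → Set X)
    (k : K) : ParityGraph X :=
  (G.deletePriority p).restrict (G.remaining p A k)

end ParityGraph

/-! ## Ordered trees, Strahler numbers, attractor decompositions -/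

/-- Ordered trees: a node has a well-ordered family of children. A leaf is a node without
children. -/
inductive OrdTree : Type (u + 1)
  | node (K : Type u) [LinearOrder K] [WellFoundedLT K] (child : K → OrdTree) : OrdTree

/-- The `n`-Strahler number. It is `1` for a leaf. For another node, let `m` be the maximum of the
`n`-Strahler numbers of its children; it is `m + 1` if at least `n + 1` children have `n`-Strahler
number `m`, and `m` otherwise. (On a tree of finite depth it is a natural number and the supremum
is attained.) -/
noncomputable def OrdTree.strahler (n : ℕ) : OrdTree.{u} → ℕ∞
  | @OrdTree.node K _ _ child =>
    open Classical in
    if IsEmpty K then 1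
    else if (n : ℕ∞) + 1 ≤
        {k : K | (child k).strahler n = ⨆ k' : K, (child k').strahler n}.encard then
      (⨆ k' : K, (child k').strahler n) + 1
    else ⨆ k' : K, (child k').strahler n

/-- `AttractorDecomposition G m` is the type of attractor decompositions of `G` of level `2 * m`.
The set `H` is the set of edges of priority `2 * m` and `A₀` is its attractor in `G`.

* `leaf`: all vertices are in `A₀`. This covers level `0` and width `0`.
* `node`: the indices `k : K` (a well-ordered set) stand for the ordinals `0 < i < ℓ`; each comes
  with a set `S k`, its attractor `A k` and a decomposition of `S k` of the next lower level. -/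
inductive AttractorDecomposition {X : Type u} : ParityGraph X → ℕ → Type (u + 1)
  | leaf (G : ParityGraph X) (m : ℕ)
      (prio_le : G.PrioritiesLE (2 * m))
      (cover : G.verts = G.attrEdges (G.edgesOf (2 * m))) :
      AttractorDecomposition G m
  | node (G : ParityGraph X) (m : ℕ)
      (prio_le : G.PrioritiesLE (2 * (m + 1)))
      (K : Type u) [LinearOrder K] [WellFoundedLT K]
      (S A : K → Set X)
      (S_nonempty : ∀ k, (S k).Nonempty)
      (S_subset : ∀ k, S k ⊆ G.remaining (2 * (m + 1)) A k)
      (S_prio_le : ∀ k, ((G.deletePriority (2 * (m + 1))).restrict (S k)).PrioritiesLE (2 * m))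
      (S_noTerminal : ∀ k, ((G.deletePriority (2 * (m + 1))).restrict (S k)).NoTerminal)
      (S_closed : ∀ k, ∀ x ∈ S k, ∀ y,
        (G.remainingGraph (2 * (m + 1)) A k).Adj x y → y ∈ S k)
      (A_eq : ∀ k, A k = (G.remainingGraph (2 * (m + 1)) A k).attrVerts (S k))
      (D : ∀ k, AttractorDecomposition ((G.deletePriority (2 * (m + 1))).restrict (S k)) m)
      (cover : G.verts = G.attrEdges (G.edgesOf (2 * (m + 1))) ∪ ⋃ k, A k) :
      AttractorDecomposition G (m + 1)

/-- The tree-shape of an attractor decomposition. -/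
def AttractorDecomposition.treeShape {X : Type u} :
    {G : ParityGraph X} → {m : ℕ} → AttractorDecomposition G m → OrdTree.{u}
  | _, _, .leaf _ _ _ _ => .node PEmpty.{u + 1} fun k => k.elim
  | _, _, @AttractorDecomposition.node _ _ _ _ K _ _ _ _ _ _ _ _ _ _ D _ =>
    .node K fun k => (D k).treeShape

/-! ## Parity games -/

/-- A parity game of index `I`: the vertices in `eve` belong to Eve, the others to Adam. -/
structure ParityGame (V : Type u) (I : Finset ℕ) where
  Adj : V → V → Prop
  exists_succ : ∀ v, ∃ w, Adj v w
  label : V → V → ℕ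
  label_mem : ∀ {v w}, Adj v w → label v w ∈ I
  eve : Set V

namespace ParityGame

variable {V : Type u} {I : Finset ℕ}

/-- A strategy for Eve. Finite plays are nonempty lists of vertices, the most recent vertex
first. -/
structure Strategy (G : ParityGame V I) where
  next : List V → V
  legal : ∀ v past, v ∈ G.eve → G.Adj v (next (v :: past))

/-- The first `k + 1` vertices of a play, the most recent one first. -/
def history (ρ : ℕ → V) : ℕ → List V
  | 0 => [ρ 0]
  | k + 1 => ρ (k + 1) :: history ρ k

/-- `ρ` is a play from `v` that is consistent with `σ`. -/
def IsConsistentPlay (G : ParityGame V I) (σ : G.Strategy) (v : V) (ρ : ℕ → V) : Prop :=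
  ρ 0 = v ∧ (∀ k, G.Adj (ρ k) (ρ (k + 1))) ∧
    ∀ k, ρ k ∈ G.eve → ρ (k + 1) = σ.next (history ρ k)

/-- `σ` is winning for Eve from `v`. -/
def Strategy.WinningFrom {G : ParityGame V I} (σ : G.Strategy) (v : V) : Prop :=
  ∀ ρ, G.IsConsistentPlay σ v ρ → ParityAccepting fun k => G.label (ρ k) (ρ (k + 1))

/-- The finite plays that start in `W` and are consistent with `σ`. -/
inductive ConsistentHistory (G : ParityGame V I) (σ : G.Strategy) (W : Set V) : List V → Prop
  | start (v : V) (hv : v ∈ W) : ConsistentHistory G σ W [v]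
  | step (v w : V) (past : List V) (h : ConsistentHistory G σ W (v :: past)) (hvw : G.Adj v w)
      (hw : v ∈ G.eve → w = σ.next (v :: past)) : ConsistentHistory G σ W (w :: v :: past)

/-- The priority of the last move of a finite play that extends another one by one move. -/
def historyLabel (G : ParityGame V I) : List V → List V → ℕ
  | v :: _, w :: _ => G.label v w
  | _, _ => 0

/-- The parity graph induced by a strategy: the unfolding of the game from the vertices of `W`,
without the moves that Eve does not choose. -/
def induced (G : ParityGame V I) (σ : G.Strategy) (W : Set V) : ParityGraph (List V) where
  verts := {l | G.ConsistentHistory σ W l}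
  Adj l l' := G.ConsistentHistory σ W l ∧ G.ConsistentHistory σ W l' ∧ ∃ w, l' = w :: l
  adj_mem h := ⟨h.1, h.2.1⟩
  label := G.historyLabel

/-- The game `G`, played from the vertices of `W`, has `n`-Strahler number `h`: Eve has a strategy,
winning from all vertices of `W`, whose induced parity graph has an attractor decomposition with a
tree-shape of `n`-Strahler number `h`. The level `2 * m` of the decomposition may exceed the largest
priority of the index by at most one. -/
def HasStrahlerNumber (G : ParityGame V I) (W : Set V) (n h : ℕ) : Prop :=
  ∃ σ : G.Strategy, (∀ v ∈ W, σ.WinningFrom v) ∧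
    ∃ m : ℕ, 2 * m ≤ I.sup id + 1 ∧
      ∃ D : AttractorDecomposition (G.induced σ W) m, D.treeShape.strahler n = (h : ℕ∞)

end ParityGame

/-! ## Priority transduction games -/

/-- The contents of the registers `r_j` and of the counters `c_{i,j}`. Only the registers of the
game at hand and the counters with odd `i` matter. -/
structure RegConfig where
  reg : ℕ → ℕ
  cnt : ℕ → ℕ → ℕ

/-- For the output index `J`, there is a register `r_j` for every even `2 * j ∈ J`, and a register
`r_0` if `1 ∈ J`. -/
def IsRegister (J : Finset ℕ) (j : ℕ) : Prop :=
  2 * j ∈ J ∨ (j = 0 ∧ 1 ∈ J)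

namespace RegConfig

/-- All registers hold the maximal even priority of the index `I`, all counters are `0`. -/
def init (I : Finset ℕ) : RegConfig where
  reg _ := (I.filter Even).sup id
  cnt _ _ := 0

/-- Choosing `r_j` makes the counter of `r_j` and its (odd) content exceed the bound `n`. -/
def Overflow (n : ℕ) (c : RegConfig) (j : ℕ) : Prop :=
  j ≠ 0 ∧ Odd (c.reg j) ∧ c.cnt (c.reg j) j = n

open Classical in
/-- The output produced when `r_j` is chosen. -/
noncomputable def output (n : ℕ) (c : RegConfig) (j : ℕ) : ℕ :=
  if j = 0 then 1 else if c.Overflow n j then 2 * j + 1 else 2 * j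

open Classical in
/-- The counters after the output: if the chosen register `r_j`, `j ≠ 0`, has an odd content, then
its counter is increased, or reset if it exceeds `n`. -/
noncomputable def countersAfterOutput (n : ℕ) (c : RegConfig) (j : ℕ) (x y : ℕ) : ℕ :=
  if j ≠ 0 ∧ Odd (c.reg j) ∧ x = c.reg j ∧ y = j then
    (if c.cnt x y = n then 0 else c.cnt x y + 1)
  else c.cnt x y

/-- The configuration after the choice of the register `r_j` and of the priority `i`. -/
noncomputable def update (n : ℕ) (c : RegConfig) (j i : ℕ) : RegConfig where
  reg y := if y = j then i else if j < y then max i (c.reg y) else c.reg y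
  cnt x y := if (x < i ∧ y = j) ∨ (x = c.reg j ∧ y < j) then 0 else c.countersAfterOutput n j x y

end RegConfig

/-- One round of the transduction game: the new position, the index of the register chosen by Eve,
and the priority used for the update. -/
structure RegRound (V : Type u) where
  pos : V
  reg : ℕ
  prio : ℕ

namespace ParityGame

variable {V : Type u} {I : Finset ℕ}

/-- The priorities that may be used for the update after a move of priority `p`: `p` itself if it is
even, and any odd priority `i ≥ p` of the index if `p` is odd. -/
def IsUpdatePriority (I : Finset ℕ) (p i : ℕ) : Prop :=
  (Even p ∧ i = p) ∨ (Odd p ∧ Odd i ∧ i ∈ I ∧ p ≤ i)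

/-- The current position after some rounds (the most recent one first) of a play from `v₀`. -/
def currentPos (v₀ : V) : List (RegRound V) → V
  | [] => v₀
  | r :: _ => r.pos

/-- A strategy for Eve in the transduction game over `G` from `v₀` with output index `J`: her moves
in `G`, and, after each move in `G`, her choice of a register and of the update priority. -/
structure RegStrategy (G : ParityGame V I) (J : Finset ℕ) (v₀ : V) where
  move : List (RegRound V) → V
  move_legal : ∀ l, currentPos v₀ l ∈ G.eve → G.Adj (currentPos v₀ l) (move l)
  reg : List (RegRound V) → V → ℕ
  reg_legal : ∀ l w, G.Adj (currentPos v₀ l) w → IsRegister J (reg l w)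
  prio : List (RegRound V) → V → ℕ
  prio_legal : ∀ l w, G.Adj (currentPos v₀ l) w →
    IsUpdatePriority I (G.label (currentPos v₀ l) w) (prio l w)

/-- The first `k` rounds of a play, the most recent one first. -/
def regHistory (ρ : ℕ → RegRound V) : ℕ → List (RegRound V)
  | 0 => []
  | k + 1 => ρ k :: regHistory ρ k

/-- The configuration after the first `k` rounds, with counters bounded by `n`. -/
noncomputable def regConfig (I : Finset ℕ) (n : ℕ) (ρ : ℕ → RegRound V) : ℕ → RegConfig
  | 0 => RegConfig.init I
  | k + 1 => (regConfig I n ρ k).update n (ρ k).reg (ρ k).prio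

/-- `ρ` is a play of the transduction game from `v₀` that is consistent with the strategy `τ`. -/
def IsConsistentRegPlay (G : ParityGame V I) {J : Finset ℕ} {v₀ : V} (τ : G.RegStrategy J v₀)
    (ρ : ℕ → RegRound V) : Prop :=
  ∀ k,
    G.Adj (currentPos v₀ (regHistory ρ k)) (ρ k).pos ∧
    (currentPos v₀ (regHistory ρ k) ∈ G.eve → (ρ k).pos = τ.move (regHistory ρ k)) ∧
    (ρ k).reg = τ.reg (regHistory ρ k) (ρ k).pos ∧
    (ρ k).prio = τ.prio (regHistory ρ k) (ρ k).pos

/-- Eve wins the `J, n`-priority transduction game over `G` from `v₀`: she has a strategy such that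
in each consistent play she never loses instantly (this happens when a counter of `r_j` overflows
and `2 * j + 1 ∉ J`) and the sequence of outputs is accepting. -/
def EveWinsReg (G : ParityGame V I) (J : Finset ℕ) (n : ℕ) (v₀ : V) : Prop :=
  ∃ τ : G.RegStrategy J v₀, ∀ ρ, G.IsConsistentRegPlay τ ρ →
    (∀ k, ¬ ((regConfig I n ρ k).Overflow n (ρ k).reg ∧ 2 * (ρ k).reg + 1 ∉ J)) ∧
    ParityAccepting fun k => (regConfig I n ρ k).output n (ρ k).reg

end ParityGame

/-! ## The strategy in the transduction game -/

/-! Eve follows `σ` in `G` and lets the register `r_s` serve the nodes of Strahler number `s` in the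
attractor decomposition of the induced graph. Every edge belongs to the deepest node whose graph
contains it. If the edge has the top priority of that node, and `s` is the number of the node, Eve
chooses `r_s`; at other even priorities she chooses `r_0`. Along edges of smaller priority the index
of the current attractor never increases. When such an edge leaves a child whose number `s` equals
that of its node, of level `d`, Eve owes a choice of `r_s` with update priority `d - 1`. She pays at
odd priorities, the largest indebted register first.

A node of number `s` has at most `n` children of number `s`, since otherwise its own number would be
larger. The nodes of number `s` around a vertex are nested and differ in level, so the counter of
`r_s` for the odd value `x` can be charged to the children of number `s` that were passed at level
`x + 1`. Up to one unit for the current content of `r_s`, the counter stays within that count, which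
is at most `n`; hence the bound `n + 1`. This is `RegConfig.Invariant`, preserved by
`RegConfig.Invariant.step`. Applied at the root it shows that `r_h` never overflows, and an overflow
of a smaller register still outputs a priority in `[1, 2h]`.

For acceptance, every infinite path ends up in the graph of one node whose top priority recurs. Let
`s` be its number. Eventually only registers up to `r_s` are chosen, and an occurrence of the top
priority frees `r_s` from its history, after which it no longer overflows. So the outputs have limit
superior `2 * s` (`IsRun.parityAccepting`). The required levels and counts are built by induction on
the decomposition (`ParityGraph.NodeSets.ranking`). -/

/-- The position of an edge in an attractor decomposition: the Strahler number and the level of the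
deepest node whose graph contains the edge, and whether the edge leaves a child of that node which
has the same Strahler number. -/
structure EdgeEvent where
  rank : ℕ
  level : ℕ
  leaves : Prop

namespace EdgeEvent

open Classical in
/-- The pending levels of the registers after a move of priority `p`, before a register is
chosen. The value `0` means that nothing is pending. -/
noncomputable def pend (e : EdgeEvent) (p : ℕ) (M : ℕ → ℕ) (j : ℕ) : ℕ :=
  if j < e.rank then 0
  else if j = e.rank then
    if p = e.level then (if M j < e.level then 0 else M j)
    else if e.leaves then max (M j) (e.level - 1) else M j
  else M j

open Classical in
/-- The register chosen by Eve. -/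
noncomputable def chooseReg (h : ℕ) (e : EdgeEvent) (p : ℕ) (M : ℕ → ℕ) : ℕ :=
  if Odd p then Nat.findGreatest (fun j => e.pend p M j ≠ 0) h
  else if p = e.level then e.rank else 0

open Classical in
/-- The update priority chosen by Eve. -/
noncomputable def choosePrio (h : ℕ) (e : EdgeEvent) (p : ℕ) (M : ℕ → ℕ) : ℕ :=
  if Odd p then max (e.pend p M (e.chooseReg h p M)) p else p

open Classical in
/-- The pending levels after the round. -/
noncomputable def nextMemory (h : ℕ) (e : EdgeEvent) (p : ℕ) (M : ℕ → ℕ) : ℕ → ℕ :=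
  if Odd p then Function.update (e.pend p M) (e.chooseReg h p M) 0 else e.pend p M

variable {e : EdgeEvent} {p h : ℕ} {M : ℕ → ℕ}

theorem pend_of_lt {j : ℕ} (hj : j < e.rank) : e.pend p M j = 0 := by
  simp [pend, hj]

theorem pend_of_gt {j : ℕ} (hj : e.rank < j) : e.pend p M j = M j := by
  simp [pend, hj.not_gt, hj.ne']

theorem pend_le_max (j : ℕ) : e.pend p M j ≤ max (M j) (e.level - 1) := by
  unfold pend; split_ifs <;> simp

theorem pend_eq_zero_or_odd (he : Even e.level) {j : ℕ} (hM : M j = 0 ∨ Odd (M j)) :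
    e.pend p M j = 0 ∨ Odd (e.pend p M j) := by
  have : e.level - 1 = 0 ∨ Odd (e.level - 1) := by
    obtain ⟨a, ha⟩ := he
    rcases Nat.eq_zero_or_pos a with h0 | h0
    · omega
    · exact .inr ⟨a - 1, by omega⟩
  unfold pend
  split_ifs
  · exact .inl rfl
  · exact .inl rfl
  · exact hM
  · rcases max_choice (M j) (e.level - 1) with h | h <;> rw [h]
    · exact hM
    · exact this
  · exact hM
  · exact hM

theorem nextMemory_eq_zero_or_odd (he : Even e.level) {j : ℕ} (hM : M j = 0 ∨ Odd (M j)) :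
    e.nextMemory h p M j = 0 ∨ Odd (e.nextMemory h p M j) := by
  unfold nextMemory
  split_ifs
  · rw [Function.update_apply]
    split_ifs
    · exact .inl rfl
    · exact pend_eq_zero_or_odd he hM
  · exact pend_eq_zero_or_odd he hM

theorem chooseReg_odd (hp : Odd p) :
    e.chooseReg h p M = Nat.findGreatest (fun j => e.pend p M j ≠ 0) h := by
  simp [chooseReg, hp]

theorem chooseReg_even (hp : ¬ Odd p) :
    e.chooseReg h p M = if p = e.level then e.rank else 0 := by
  simp only [chooseReg, hp, if_false]

theorem choosePrio_odd (hp : Odd p) :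
    e.choosePrio h p M = max (e.pend p M (e.chooseReg h p M)) p := by
  simp [choosePrio, hp]

theorem choosePrio_even (hp : ¬ Odd p) : e.choosePrio h p M = p := by
  simp [choosePrio, hp]

theorem nextMemory_odd (hp : Odd p) :
    e.nextMemory h p M = Function.update (e.pend p M) (e.chooseReg h p M) 0 := by
  simp [nextMemory, hp]

theorem nextMemory_even (hp : ¬ Odd p) : e.nextMemory h p M = e.pend p M := by
  simp [nextMemory, hp]

theorem nextMemory_le (j : ℕ) : e.nextMemory h p M j ≤ e.pend p M j := by
  by_cases hp : Odd p
  · rw [nextMemory_odd hp, Function.update_apply]; split_ifs <;> simp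
  · rw [nextMemory_even hp]

theorem chooseReg_le (he : e.rank ≤ h) : e.chooseReg h p M ≤ h := by
  by_cases hp : Odd p
  · rw [chooseReg_odd hp]; exact Nat.findGreatest_le h
  · rw [chooseReg_even hp]; split_ifs <;> omega

/-- If `j` is the largest pending register, then it is chosen. -/
theorem chooseReg_eq (hp : Odd p) {j : ℕ} (hj : j ≤ h) (h0 : e.pend p M j ≠ 0)
    (hgt : ∀ i, j < i → i ≤ h → e.pend p M i = 0) : e.chooseReg h p M = j := by
  classical
  rw [chooseReg_odd hp, Nat.findGreatest_eq_iff]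
  exact ⟨hj, fun _ => h0, fun i h1 h2 => by simp [hgt i h1 h2]⟩

theorem chooseReg_lt (hp : Odd p) {j : ℕ} (hj : 0 < j)
    (hgt : ∀ i, j ≤ i → i ≤ h → e.pend p M i = 0) : e.chooseReg h p M < j := by
  classical
  by_contra hc
  push Not at hc
  have h2 : e.chooseReg h p M ≤ h := by
    rw [chooseReg_odd hp]; exact Nat.findGreatest_le h
  have h3 := hgt _ hc h2
  have : e.pend p M (e.chooseReg h p M) ≠ 0 := by
    rw [chooseReg_odd hp] at hc ⊢
    exact Nat.findGreatest_of_ne_zero (P := fun j => e.pend p M j ≠ 0) rfl (by omega)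
  exact this h3

end EdgeEvent

/-! ## Ranked edges -/

/-- The conditions on the event `e` of an edge of priority `p` in a graph of level `d` and Strahler
number `s`. Here `t₁` and `t₂` are the levels of the deepest nodes of Strahler number `s` around the
end points, and `P₁`, `P₂` count the children of Strahler number `s` that were passed, by level. -/
structure RankedEdge (d s : ℕ) (e : EdgeEvent) (p t₁ t₂ : ℕ) (P₁ P₂ : ℕ → ℕ) : Prop where
  rank_pos : 1 ≤ e.rank
  rank_le : e.rank ≤ s
  level_even : Even e.level
  level_le : e.level ≤ d
  prio_le : p ≤ e.level
  -- The edge lies inside a child of smaller Strahler number.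
  below : e.rank < s → e.level < t₁ ∧ t₂ = t₁ ∧ ∀ x < d, P₁ x ≤ P₂ x
  -- Such an edge may lead anywhere inside its node, so only the counts of the surrounding nodes are
  -- kept.
  top : e.rank = s → p = e.level →
    t₁ ≤ e.level ∧ t₂ ≤ e.level ∧ ∀ x < d, e.level < x → P₁ x ≤ P₂ x
  -- The children of a node of level `e.level` are counted at the odd value `e.level - 1`.
  leave : e.rank = s → p ≠ e.level → e.leaves →
    t₁ < e.level ∧ t₂ ≤ e.level ∧ P₁ (e.level - 1) + 1 ≤ P₂ (e.level - 1) ∧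
      ∀ x < d, e.level ≤ x → P₁ x ≤ P₂ x
  stay : e.rank = s → p ≠ e.level → ¬ e.leaves →
    t₁ = e.level ∧ t₂ ≤ e.level ∧ ∀ x < d, P₁ x ≤ P₂ x

/-- The admissible levels and counts of a vertex. -/
structure RankedVertex (n d t : ℕ) (P : ℕ → ℕ) : Prop where
  even : Even t
  le : t ≤ d
  count_le : ∀ x, P x ≤ n

/-! ### Loads and the invariant of a register. -/

namespace RegConfig

variable {c c' : RegConfig} {n d s t t₁ t₂ y x i j : ℕ} {P P₁ P₂ : ℕ → ℕ}

/-- The counter of `r_s` and `x`, increased by one if `r_s` contains `x`. -/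
def load (c : RegConfig) (s x : ℕ) : ℕ := c.cnt x s + if c.reg s = x then 1 else 0

/-- Nothing is pending: the counters of `r_s` at the levels below `t` are at most `P`, and those at
higher levels at most `P + 1`, where the next choice of `r_s` is counted already. -/
def Settled (d s t : ℕ) (P : ℕ → ℕ) (c : RegConfig) : Prop :=
  ∀ x < d, Odd x → (x < t → c.cnt x s ≤ P x) ∧ (t < x → c.load s x ≤ P x + 1)

/-- The register `r_s` has to be chosen at the next odd priority, with update priority `y`. -/
structure Pending (n d s y t : ℕ) (P : ℕ → ℕ) (c : RegConfig) : Prop where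
  odd : Odd y
  lt : y < d
  level_le : t ≤ y + 1
  load_self : c.load s y ≤ P y
  load_above : ∀ x < d, Odd x → y < x → c.load s x ≤ P x + 1
  -- The owed choice of `r_s` with priority `y` resets these counters; until then it is enough that
  -- none overflows.
  load_below : ∀ x < y, Odd x → c.load s x ≤ n + 1

theorem load_of_ne (h : c.reg s ≠ x) : c.load s x = c.cnt x s := by simp [load, h]

theorem load_le : c.load s x ≤ c.cnt x s + 1 := by unfold load; split_ifs <;> omega

theorem reg_update_self : (c.update n j i).reg j = i := by simp [update]

theorem reg_update_of_lt (h : j < s) : (c.update n j i).reg s = max i (c.reg s) := by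
  simp [update, h, h.ne']

theorem cnt_update_of_lt (h : j < s) : (c.update n j i).cnt x s = c.cnt x s := by
  simp [update, countersAfterOutput, h.ne', h.not_gt]

theorem cnt_update_self_of_lt (h : x < i) : (c.update n s i).cnt x s = 0 := by
  simp [update, h]

/-- The load counts the increment in advance, so choosing `r_s` turns a bound on the load into one
on the counter. -/
theorem cnt_update_self_le : (c.update n s i).cnt x s ≤ c.load s x := by
  by_cases h : c.reg s = x
  · simp only [update, countersAfterOutput, load, h]
    split_ifs <;> simp
  · have : x ≠ c.reg s := fun h' => h h'.symm
    simp only [update, countersAfterOutput, load, h, this]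
    simp only [false_and, and_false, or_false, if_false, add_zero]
    split_ifs <;> simp

/-- A move that leaves `r_s` alone does not increase the load of `x`, unless `x` is recorded. -/
theorem load_update_of_lt (h : j < s) (hx : i ≠ x) :
    (c.update n j i).load s x ≤ c.load s x := by
  unfold load
  rw [cnt_update_of_lt h, reg_update_of_lt h]
  rcases max_choice i (c.reg s) with h1 | h1 <;> rw [h1]
  simp [hx]

theorem load_update_self (hx : i ≠ x) : (c.update n s i).load s x ≤ c.load s x := by
  rw [load_of_ne (by rwa [reg_update_self])]
  exact cnt_update_self_le

/-- Choosing `r_s` with the pending priority settles everything. -/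
theorem Pending.settled_update (h : Pending n d s y t P c) {N : ℕ} :
    Settled d s t P (c.update N s y) := by
  intro x hx hodd
  have key : (c.update N s y).cnt x s ≤ P x ∨ t < x ∧ (c.update N s y).load s x ≤ P x + 1 := by
    rcases lt_trichotomy x y with h1 | h1 | h1
    · left; rw [cnt_update_self_of_lt h1]; omega
    · left; subst h1; exact cnt_update_self_le.trans h.load_self
    · refine .inr ⟨?_, (load_update_self h1.ne).trans (h.load_above x hx hodd h1)⟩
      -- Both `x` and `y` are odd, so `y < x` gives `t ≤ y + 1 < x`.
      have := h.level_le
      obtain ⟨a, ha⟩ := hodd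
      obtain ⟨b, hb⟩ := h.odd
      omega
  refine ⟨fun hlt => ?_, fun hlt => ?_⟩
  · rcases key with h1 | h1
    · exact h1
    · omega
  · rcases key with h1 | h1
    · exact load_le.trans (by omega)
    · exact h1.2

theorem Pending.mono_load (h : Pending n d s y t P c)
    (hl : ∀ x, Odd x → c'.load s x ≤ c.load s x) : Pending n d s y t P c' where
  odd := h.odd
  lt := h.lt
  level_le := h.level_le
  load_self := (hl y h.odd).trans h.load_self
  load_above x hx ho hy := (hl x ho).trans (h.load_above x hx ho hy)
  load_below x hx ho := (hl x ho).trans (h.load_below x hx ho)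

theorem Pending.mono (h : Pending n d s y t₁ P₁ c) (ht : t₂ ≤ y + 1)
    (hP : ∀ x < d, y ≤ x → P₁ x ≤ P₂ x) : Pending n d s y t₂ P₂ c where
  odd := h.odd
  lt := h.lt
  level_le := ht
  load_self := h.load_self.trans (hP y h.lt le_rfl)
  load_above x hx ho hy := (h.load_above x hx ho hy).trans (by have := hP x hx hy.le; omega)
  load_below := h.load_below

/-- The invariant of a play in a graph of level `d` and Strahler number `s`. -/
structure Invariant (n h d s t : ℕ) (P : ℕ → ℕ) (c : RegConfig) (M : ℕ → ℕ) : Prop where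
  mem_above : ∀ j, s < j → j ≤ h → M j = 0
  -- The value recorded by a smaller register also enters `r_s` through the maximum; below `t` this
  -- is harmless.
  mem_below : ∀ j < s, M j ≠ 0 → M j < t
  reg_lt : Odd (c.reg s) → c.reg s < d
  settled : M s = 0 → Settled d s t P c
  pending : M s ≠ 0 → Pending n d s (M s) t P c

theorem Settled.load_le (hs : Settled d s t P c) (hv : RankedVertex n d t P)
    (hx : x < d) (ho : Odd x) : c.load s x ≤ n + 1 := by
  rcases lt_trichotomy x t with h1 | h1 | h1
  · exact RegConfig.load_le.trans (by have := (hs x hx ho).1 h1; have := hv.count_le x; omega)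
  · have := hv.even
    rw [← h1, ← Nat.not_odd_iff_even] at this
    exact absurd ho this
  · exact ((hs x hx ho).2 h1).trans (by have := hv.count_le x; omega)

theorem Invariant.load_le {h : ℕ} {M : ℕ → ℕ} (hI : Invariant n h d s t P c M)
    (hv : RankedVertex n d t P) (hx : x < d) (ho : Odd x) : c.load s x ≤ n + 1 := by
  by_cases hM : M s = 0
  · exact (hI.settled hM).load_le hv hx ho
  · have hp := hI.pending hM
    rcases lt_trichotomy x (M s) with h1 | h1 | h1
    · exact hp.load_below x h1 ho
    · rw [h1]; exact hp.load_self.trans ((hv.count_le _).trans (by omega))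
    · exact (hp.load_above x hx ho h1).trans (by have := hv.count_le x; omega)

/-- On overflow the counter `n + 1` together with the content of `r_s` would make a load of `n + 2`.
-/
theorem Invariant.not_overflow {h : ℕ} {M : ℕ → ℕ} (hI : Invariant n h d s t P c M)
    (hv : RankedVertex n d t P) : ¬ c.Overflow (n + 1) s := by
  rintro ⟨_, ho, hc⟩
  have := hI.load_le hv (hI.reg_lt ho) ho
  unfold load at this
  simp only [if_true] at this
  omega

/-- Leaving a child makes its level pending. -/
theorem Invariant.pending_leave {h : ℕ} {M : ℕ → ℕ} (hI : Invariant n h d s t₁ P₁ c M)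
    (hv : RankedVertex n d t₁ P₁) (hy : Odd y) (hyd : y < d) (ht₁ : t₁ < y) (ht₂ : t₂ ≤ y + 1)
    (hPy : P₁ y + 1 ≤ P₂ y) (hP : ∀ x < d, y < x → P₁ x ≤ P₂ x) :
    Pending n d s (max (M s) y) t₂ P₂ c := by
  have hP' : ∀ x < d, y ≤ x → P₁ x ≤ P₂ x := fun x hx hyx => by
    rcases hyx.eq_or_lt with rfl | h1
    · omega
    · exact hP x hx h1
  have habove : M s < y → ∀ x < d, Odd x → y ≤ x → c.load s x ≤ P₁ x + 1 := by
    intro hMy x hx ho hyx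
    by_cases hM : M s = 0
    · exact (hI.settled hM x hx ho).2 (by omega)
    · exact (hI.pending hM).load_above x hx ho (by omega)
  -- A debt at a lower level is absorbed by the new one at `y`; a debt at `y` or above already
  -- covers the new one.
  rcases lt_or_ge (M s) y with h1 | h1
  · rw [max_eq_right h1.le]
    exact
      { odd := hy
        lt := hyd
        level_le := ht₂
        load_self := (habove h1 y hyd hy le_rfl).trans hPy
        load_above := fun x hx ho hyx =>
          (habove h1 x hx ho hyx.le).trans (by have := hP x hx hyx; omega)
        load_below := fun x hx ho => hI.load_le hv (hx.trans hyd) ho }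
  · rw [max_eq_left h1]
    have hM : M s ≠ 0 := by have := hy.pos; omega
    exact (hI.pending hM).mono (by omega) fun x hx hyx => hP' x hx (h1.trans hyx)

end RegConfig

/-! ### One round preserves the invariant. -/

namespace RegConfig

variable {c : RegConfig} {n h d s p t₁ t₂ : ℕ} {P₁ P₂ M : ℕ → ℕ} {e : EdgeEvent}

/-- A round with an odd priority `p` restores the invariant if what is pending before the choice of
the register fits the new position. -/
theorem Invariant.finish_odd {N : ℕ} (hI : Invariant n h d s t₁ P₁ c M) (hs : s ≤ h)
    (h0 : 0 < e.rank) (hr : e.rank ≤ s) (hp : Odd p)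
    (hpend : e.pend p M s ≠ 0 → p ≤ e.pend p M s ∧ Pending n d s (e.pend p M s) t₂ P₂ c)
    (hsett : e.pend p M s = 0 → p < d ∧ (∀ j < s, e.pend p M j ≠ 0 → e.pend p M j < d) ∧
      ∀ j i, j < s → (i = p ∨ i = e.pend p M j ∧ i ≠ 0) → Settled d s t₂ P₂ (c.update N j i))
    (hbelow : ∀ j < s, e.pend p M j ≠ 0 → e.pend p M j < t₂) :
    e.chooseReg h p M ≤ s ∧
      Invariant n h d s t₂ P₂ (c.update N (e.chooseReg h p M) (e.choosePrio h p M))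
        (e.nextMemory h p M) := by
  have habove : ∀ j, s < j → j ≤ h → e.pend p M j = 0 := fun j h1 h2 => by
    rw [EdgeEvent.pend_of_gt (by omega)]; exact hI.mem_above j h1 h2
  have hmemb : ∀ j < s, e.nextMemory h p M j ≠ 0 → e.nextMemory h p M j < t₂ := fun j h1 h2 => by
    have h3 := EdgeEvent.nextMemory_le (e := e) (h := h) (p := p) (M := M) j
    have h4 := hbelow j h1 (by omega)
    omega
  have hmema : ∀ j, s < j → j ≤ h → e.nextMemory h p M j = 0 := fun j h1 h2 => by
    have h3 := EdgeEvent.nextMemory_le (e := e) (h := h) (p := p) (M := M) j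
    have h4 := habove j h1 h2
    omega
  by_cases hM : e.pend p M s = 0
  · have hlt : e.chooseReg h p M < s := by
      refine EdgeEvent.chooseReg_lt hp (by omega) fun i h1 h2 => ?_
      rcases h1.eq_or_lt with rfl | h1
      · exact hM
      · exact habove i h1 h2
    obtain ⟨hpd, hMd, hset⟩ := hsett hM
    -- If `r_s` owes nothing, a smaller register is chosen, and the recorded value is the move's
    -- priority or a debt of that register.
    have hprio : e.choosePrio h p M = p ∨
        e.choosePrio h p M = e.pend p M (e.chooseReg h p M) ∧ e.choosePrio h p M ≠ 0 := by
      rw [EdgeEvent.choosePrio_odd hp]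
      have := hp.pos
      omega
    refine ⟨hlt.le, hmema, hmemb, fun ho => ?_, fun _ => hset _ _ hlt hprio, fun hn => ?_⟩
    · rw [reg_update_of_lt hlt] at ho ⊢
      have h1 : e.choosePrio h p M < d := by
        rcases hprio with h1 | h1
        · omega
        · have := hMd _ hlt (by omega)
          omega
      rcases max_choice (e.choosePrio h p M) (c.reg s) with h2 | h2
      · omega
      · rw [h2] at ho ⊢
        exact hI.reg_lt ho
    · have h3 := EdgeEvent.nextMemory_le (e := e) (h := h) (p := p) (M := M) s
      omega
  · have heq : e.chooseReg h p M = s := EdgeEvent.chooseReg_eq hp hs hM habove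
    obtain ⟨hpm, hP⟩ := hpend hM
    have hprio : e.choosePrio h p M = e.pend p M s := by
      rw [EdgeEvent.choosePrio_odd hp, heq]; omega
    rw [heq, hprio]
    refine ⟨le_rfl, hmema, hmemb, fun _ => ?_, fun _ => hP.settled_update, fun hn => ?_⟩
    · rw [reg_update_self]; exact hP.lt
    · rw [EdgeEvent.nextMemory_odd hp, heq] at hn
      simp at hn

/-- A round with an even priority `p` in which a register below `r_s` is chosen restores the
invariant if what is pending fits the new position. -/
theorem Invariant.finish_even {N j : ℕ} (hI : Invariant n h d s t₁ P₁ c M) (hj : j < s)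
    (hr : e.rank ≤ s) (hp : ¬ Odd p)
    (hpend : e.pend p M s ≠ 0 → Pending n d s (e.pend p M s) t₂ P₂ c)
    (hsett : e.pend p M s = 0 → Settled d s t₂ P₂ (c.update N j p))
    (hbelow : ∀ j < s, e.pend p M j ≠ 0 → e.pend p M j < t₂) :
    Invariant n h d s t₂ P₂ (c.update N j p) (e.nextMemory h p M) := by
  rw [EdgeEvent.nextMemory_even hp]
  refine ⟨fun j h1 h2 => ?_, hbelow, fun ho => ?_, hsett, fun hn => ?_⟩
  · rw [EdgeEvent.pend_of_gt (by omega)]; exact hI.mem_above j h1 h2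
  · rw [reg_update_of_lt hj] at ho ⊢
    rcases max_choice p (c.reg s) with h2 | h2
    · rw [h2] at ho; exact absurd ho hp
    · rw [h2] at ho ⊢; exact hI.reg_lt ho
  · refine (hpend hn).mono_load fun x hx => load_update_of_lt hj ?_
    rintro rfl
    exact hp hx

/-- A move inside the gap of a settled node keeps it settled. -/
theorem Settled.update_of_lt {N i j : ℕ} (hset : Settled d s t₁ P₁ c) (hj : j < s)
    (hi : ∀ x, Odd x → t₁ < x → i ≠ x) (ht : t₂ ≤ t₁) (het : Even t₁) (hP : ∀ x < d, P₁ x ≤ P₂ x) :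
    Settled d s t₂ P₂ (c.update N j i) := by
  intro x hx ho
  have hne : x ≠ t₁ := by
    rintro rfl
    exact (Nat.not_odd_iff_even.2 het) ho
  have hPx := hP x hx
  refine ⟨fun h1 => ?_, fun h1 => ?_⟩
  · rw [cnt_update_of_lt hj]
    exact ((hset x hx ho).1 (by omega)).trans hPx
  · rcases Nat.lt_or_gt_of_ne hne with h2 | h2
    -- Between `t₂` and `t₁` only the counter was bounded; the extra unit allowed above `t₂` pays
    -- for the content of `r_s`.
    · refine RegConfig.load_le.trans ?_
      rw [cnt_update_of_lt hj]
      have := (hset x hx ho).1 h2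
      omega
    · refine (load_update_of_lt hj (hi x ho h2)).trans (((hset x hx ho).2 h2).trans (by omega))

/-- The invariant is preserved by every round, and only the registers up to `r_s` are chosen. -/
theorem Invariant.step {N : ℕ} (hI : Invariant n h d s t₁ P₁ c M) (hs : s ≤ h)
    (hv : RankedVertex n d t₁ P₁) (he : RankedEdge d s e p t₁ t₂ P₁ P₂) :
    e.chooseReg h p M ≤ s ∧
      Invariant n h d s t₂ P₂ (c.update N (e.chooseReg h p M) (e.choosePrio h p M))
        (e.nextMemory h p M) := by
  have hr0 := he.rank_pos
  have hr := he.rank_le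
  have hlev := he.level_even
  have hld := he.level_le
  have hpl := he.prio_le
  have ht₁ := hv.le
  have hodd_ne : Odd p → p ≠ e.level := by
    rintro ho rfl
    exact Nat.not_odd_iff_even.2 hlev ho
  -- moves inside a child of smaller Strahler number, and moves in the gap of a node
  have gap : p < t₁ → t₂ ≤ t₁ → (∀ x < d, P₁ x ≤ P₂ x) → e.pend p M s = M s →
      (∀ j < s, e.pend p M j ≠ 0 → e.pend p M j < t₂) → e.chooseReg h p M ≤ s ∧
      Invariant n h d s t₂ P₂ (c.update N (e.chooseReg h p M) (e.choosePrio h p M))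
        (e.nextMemory h p M) ∨ (¬ Odd p ∧ e.chooseReg h p M = s) := by
    intro hpt ht hP hMs hbelow
    have hpend : e.pend p M s ≠ 0 → Pending n d s (e.pend p M s) t₂ P₂ c := fun hn => by
      rw [hMs] at hn ⊢
      have := hI.pending hn
      exact this.mono (by have := this.level_le; omega) fun x hx _ => hP x hx
    by_cases ho : Odd p
    · left
      refine hI.finish_odd hs hr0 hr ho (fun hn => ⟨?_, hpend hn⟩) (fun hz => ⟨by omega, ?_, ?_⟩)
        hbelow
      · rw [hMs] at hn ⊢
        have := (hI.pending hn).level_le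
        omega
      · intro j h1 h2
        have := hbelow j h1 h2
        omega
      · intro j i hj hi
        refine (hI.settled (hMs ▸ hz)).update_of_lt hj (fun x _ hx => ?_) ht hv.even hP
        rcases hi with rfl | ⟨rfl, h0⟩
        · omega
        · have := hbelow j hj h0
          omega
    · by_cases hc : e.chooseReg h p M = s
      · exact .inr ⟨ho, hc⟩
      · left
        have hlt : e.chooseReg h p M < s := by
          rw [EdgeEvent.chooseReg_even ho] at hc ⊢
          split_ifs at hc ⊢ <;> omega
        rw [EdgeEvent.choosePrio_even ho]
        refine ⟨hlt.le, hI.finish_even hlt hr ho hpend (fun hz => ?_) hbelow⟩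
        refine (hI.settled (hMs ▸ hz)).update_of_lt hlt (fun x _ hx => by omega) ht hv.even hP
  rcases hr.lt_or_eq with hlt | heq
  · obtain ⟨h1, h2, h3⟩ := he.below hlt
    have hbelow : ∀ j < s, e.pend p M j ≠ 0 → e.pend p M j < t₂ := fun j hj hn => by
      have h4 := EdgeEvent.pend_le_max (e := e) (p := p) (M := M) j
      by_cases hM : M j = 0
      · omega
      · have := hI.mem_below j hj hM
        omega
    rcases gap (by omega) h2.le h3 (EdgeEvent.pend_of_gt hlt) hbelow with h4 | h4
    · exact h4
    · have h5 := h4.2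
      rw [EdgeEvent.chooseReg_even h4.1] at h5
      split_ifs at h5 <;> omega
  · have hbelow : ∀ j < s, e.pend p M j ≠ 0 → e.pend p M j < t₂ := fun j hj hn =>
      absurd (EdgeEvent.pend_of_lt (by omega)) hn
    by_cases hpe : p = e.level
    -- Recording the even value `p` in `r_s` resets its counters below `p`, and debts below `p` are
    -- cancelled: the inner levels start from zero, the outer ones keep their bounds.
    · obtain ⟨h1, h2, h3⟩ := he.top heq hpe
      have ho : ¬ Odd p := fun ho => hodd_ne ho hpe
      have hc : e.chooseReg h p M = s := by
        rw [EdgeEvent.chooseReg_even ho, if_pos hpe, heq]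
      have hMs : e.pend p M s = if M s < p then 0 else M s := by
        simp [EdgeEvent.pend, heq, hpe]
      rw [hc, EdgeEvent.choosePrio_even ho, EdgeEvent.nextMemory_even ho]
      have hloads : ∀ x, Odd x → (c.update N s p).load s x ≤ c.load s x := fun x hx =>
        load_update_self (by rintro rfl; exact ho hx)
      refine ⟨le_rfl, fun j h1 h2 => ?_, hbelow, fun h => ?_, fun hz x hx hxo => ?_, fun hn => ?_⟩
      · rw [EdgeEvent.pend_of_gt (by omega)]; exact hI.mem_above j h1 h2
      · rw [reg_update_self] at h
        exact absurd h ho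
      · have hxp : x ≠ p := by
          rintro rfl
          exact ho hxo
        have habove : p < x → (c.update N s p).load s x ≤ P₂ x + 1 := fun hpx => by
          refine (hloads x hxo).trans (le_trans ?_ (Nat.succ_le_succ (h3 x hx (by omega))))
          by_cases hM : M s = 0
          · exact (hI.settled hM x hx hxo).2 (by omega)
          · refine (hI.pending hM).load_above x hx hxo ?_
            rw [hMs] at hz
            split_ifs at hz <;> omega
        have hbel : x < p → (c.update N s p).cnt x s = 0 := fun hpx => cnt_update_self_of_lt hpx
        refine ⟨fun hxt => ?_, fun hxt => ?_⟩
        · rw [hbel (by omega)]; omega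
        · rcases Nat.lt_or_gt_of_ne hxp with h4 | h4
          · refine RegConfig.load_le.trans ?_
            rw [hbel h4]; omega
          · exact habove h4
      · rw [hMs] at hn ⊢
        split_ifs at hn ⊢ with h4
        · have hp := hI.pending (by omega)
          exact absurd rfl hn
        · have hp := hI.pending hn
          have h5 : M s ≠ p := fun h5 => ho (h5 ▸ hp.odd)
          exact (hp.mono (by omega) fun x hx hMx => h3 x hx (by omega)).mono_load hloads
    · by_cases hlv : e.leaves
      · obtain ⟨h1, h2, h3, h4⟩ := he.leave heq hpe hlv
        have hMs : e.pend p M s = max (M s) (e.level - 1) := by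
          simp [EdgeEvent.pend, heq, hpe, hlv]
        have hpos : 0 < e.level := by omega
        have hyo : Odd (e.level - 1) := by
          obtain ⟨a, ha⟩ := hlev
          exact ⟨a - 1, by omega⟩
        -- Both levels are even, so `t₁ < e.level` leaves a gap of two.
        have ht₁y : t₁ < e.level - 1 := by
          obtain ⟨a, ha⟩ := hlev
          obtain ⟨b, hb⟩ := hv.even
          omega
        have hP : Pending n d s (e.pend p M s) t₂ P₂ c := by
          rw [hMs]
          exact hI.pending_leave hv hyo (by omega) ht₁y (by omega) h3
            fun x hx hyx => h4 x hx (by omega)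
        have hne : e.pend p M s ≠ 0 := by
          rw [hMs]
          have := hyo.pos
          omega
        by_cases ho : Odd p
        · exact hI.finish_odd hs hr0 hr ho (fun _ => ⟨by rw [hMs]; omega, hP⟩)
            (fun hz => absurd hz hne) hbelow
        · rw [EdgeEvent.choosePrio_even ho, EdgeEvent.chooseReg_even ho, if_neg hpe]
          exact ⟨by omega, hI.finish_even (by omega) hr ho (fun _ => hP) (fun hz => absurd hz hne)
            hbelow⟩
      · obtain ⟨h1, h2, h3⟩ := he.stay heq hpe hlv
        have hMs : e.pend p M s = M s := by
          simp [EdgeEvent.pend, heq, hpe, hlv]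
        rcases gap (by omega) (by omega) h3 hMs hbelow with h4 | h4
        · exact h4
        · have h5 := h4.2
          rw [EdgeEvent.chooseReg_even h4.1, if_neg hpe] at h5
          omega

end RegConfig

/-! ## Runs of the strategy -/

/-- The configurations `c` and the memories `M` evolve along events `e` and priorities `p`. -/
structure IsRun (N h : ℕ) (e : ℕ → EdgeEvent) (p : ℕ → ℕ) (c : ℕ → RegConfig)
    (M : ℕ → ℕ → ℕ) : Prop where
  config : ∀ k, c (k + 1) =
    (c k).update N ((e k).chooseReg h (p k) (M k)) ((e k).choosePrio h (p k) (M k))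
  memory : ∀ k, M (k + 1) = (e k).nextMemory h (p k) (M k)

theorem RegConfig.output_le {c : RegConfig} {N r s : ℕ} (hs : 1 ≤ s) (hr : r ≤ s)
    (ho : ¬ c.Overflow N s) : c.output N r ≤ 2 * s := by
  unfold RegConfig.output
  split_ifs with h1 h2
  · omega
  · rcases hr.eq_or_lt with rfl | h3
    · exact absurd h2 ho
    · omega
  · omega

theorem RegConfig.output_eq {c : RegConfig} {N s : ℕ} (hs : 1 ≤ s)
    (ho : ¬ c.Overflow N s) : c.output N s = 2 * s := by
  unfold RegConfig.output
  rw [if_neg (by omega), if_neg ho]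

namespace IsRun

variable {n N h d s : ℕ} {e : ℕ → EdgeEvent} {p : ℕ → ℕ} {c : ℕ → RegConfig} {M : ℕ → ℕ → ℕ}
  {t : ℕ → ℕ} {P : ℕ → ℕ → ℕ}

theorem invariant_of_ge (hrun : IsRun N h e p c M) (hs : s ≤ h)
    (hv : ∀ k, RankedVertex n d (t k) (P k)) {K : ℕ}
    (he : ∀ k ≥ K, RankedEdge d s (e k) (p k) (t k) (t (k + 1)) (P k) (P (k + 1)))
    (h0 : (c K).Invariant n h d s (t K) (P K) (M K)) (k : ℕ) (hk : K ≤ k) :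
    (c k).Invariant n h d s (t k) (P k) (M k) := by
  induction k, hk using Nat.le_induction with
  | base => exact h0
  | succ k hk ih =>
    rw [hrun.config, hrun.memory]
    exact (ih.step hs (hv k) (he k hk)).2

/-- Eventually nothing is pending for the registers above `r_s`. -/
theorem exists_mem_above_eq_zero (hrun : IsRun N h e p c M) {K : ℕ}
    (hr : ∀ k ≥ K, (e k).rank ≤ s) (hodd : ∃ᶠ k in atTop, Odd (p k)) :
    ∃ k₀ ≥ K, ∀ k ≥ k₀, ∀ j, s < j → j ≤ h → M k j = 0 := by
  have keep : ∀ k ≥ K, ∀ j, s < j → M k j = 0 → M (k + 1) j = 0 := fun k hk j hj hM => by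
    rw [hrun.memory]
    have := EdgeEvent.nextMemory_le (e := e k) (h := h) (p := p k) (M := M k) j
    rw [EdgeEvent.pend_of_gt ((hr k hk).trans_lt hj), hM] at this
    omega
  have keep' : ∀ k ≥ K, ∀ j, s < j → M k j = 0 → ∀ l ≥ k, M l j = 0 := fun k hk j hj hM l hl => by
    induction l, hl using Nat.le_induction with
    | base => exact hM
    | succ l hl ih => exact keep l (hk.trans hl) j hj ih
  -- Downward induction from `r_h`: once the larger registers owe nothing, the next odd round clears
  -- the debt of the next one, and ranks at most `s` create no new debts above `r_s`.
  suffices H : ∀ i, ∃ k₀ ≥ K, ∀ k ≥ k₀, ∀ j, s < j → h < j + i → j ≤ h → M k j = 0 by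
    obtain ⟨k₀, h1, h2⟩ := H (h + 1)
    exact ⟨k₀, h1, fun k hk j hj hjh => h2 k hk j hj (by omega) hjh⟩
  intro i
  induction i with
  | zero => exact ⟨K, le_rfl, fun k _ j _ h1 h2 => by omega⟩
  | succ i ih =>
    obtain ⟨k₀, hk₀, H⟩ := ih
    obtain ⟨k₁, hk₁, ho⟩ := frequently_atTop.1 hodd k₀
    refine ⟨k₁ + 1, by omega, fun k hk j hj hji hjh => ?_⟩
    rcases Nat.lt_or_ge h (j + i) with h1 | h1
    · exact H k (by omega) j hj h1 hjh
    · refine keep' (k₁ + 1) (by omega) j hj ?_ k hk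
      by_cases hM : M k₁ j = 0
      · exact keep k₁ (by omega) j hj hM
      · have hp : ∀ j, s < j → (e k₁).pend (p k₁) (M k₁) j = M k₁ j := fun j hj =>
          EdgeEvent.pend_of_gt ((hr k₁ (by omega)).trans_lt hj)
        rw [hrun.memory, EdgeEvent.nextMemory_odd ho, EdgeEvent.chooseReg_eq ho hjh
          (by rwa [hp j hj]) fun i h2 h3 => by
            rw [hp i (by omega)]; exact H k₁ hk₁ i (by omega) (by omega) h3]
        simp

/-- If the top priority `d` is seen infinitely often, then only registers up to `r_s` are chosen
from some point on, and `r_s` does not overflow any more. -/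
theorem exists_not_overflow (hrun : IsRun (n + 1) h e p c M) (hs : s ≤ h)
    (hv : ∀ k, RankedVertex n d (t k) (P k))
    (he : ∀ᶠ k in atTop, RankedEdge d s (e k) (p k) (t k) (t (k + 1)) (P k) (P (k + 1)))
    (htop : ∃ᶠ k in atTop, p k = d ∧ (e k).rank = s ∧ (e k).level = d) :
    ∀ᶠ k in atTop, (e k).chooseReg h (p k) (M k) ≤ s ∧ ¬ (c k).Overflow (n + 1) s := by
  obtain ⟨K, he⟩ := eventually_atTop.1 he
  have hd : Even d := by
    obtain ⟨k, hk, h1, h2, h3⟩ := frequently_atTop.1 htop K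
    exact h3 ▸ (he k hk).level_even
  have hdo : ¬ Odd d := Nat.not_odd_iff_even.2 hd
  have htopReg : ∀ k, p k = d → (e k).rank = s → (e k).level = d →
      (e k).chooseReg h (p k) (M k) = s := fun k h1 h2 h3 => by
    rw [EdgeEvent.chooseReg_even (by rwa [h1]), if_pos (by omega), h2]
  by_cases hodd : ∃ᶠ k in atTop, Odd (p k)
  · obtain ⟨k₀, hk₀, habove⟩ := hrun.exists_mem_above_eq_zero (fun k hk => (he k hk).rank_le) hodd
    obtain ⟨k₁, hk₁, ho⟩ := frequently_atTop.1 hodd k₀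
    have hdpos : 0 < d := by
      have h1 := he k₁ (by omega)
      have h2 := h1.prio_le
      have h3 := h1.level_le
      have h4 := ho.pos
      omega
    -- A debt of `r_s` from before could exceed `d`; with nothing owed above, an odd round removes
    -- it.
    have hMs : M (k₁ + 1) s = 0 := by
      rw [hrun.memory]
      by_cases hM : (e k₁).pend (p k₁) (M k₁) s = 0
      · have := EdgeEvent.nextMemory_le (e := e k₁) (h := h) (p := p k₁) (M := M k₁) s
        omega
      · rw [EdgeEvent.nextMemory_odd ho, EdgeEvent.chooseReg_eq ho hs hM fun i h2 h3 => by
          rw [EdgeEvent.pend_of_gt ((he k₁ (by omega)).rank_le.trans_lt h2)]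
          exact habove k₁ hk₁ i h2 h3]
        simp
    -- New debts stem from levels at most `d`, so the next edge of priority `d` will cancel them.
    have hMd : ∀ k ≥ k₁ + 1, M k s < d := fun k hk => by
      induction k, hk using Nat.le_induction with
      | base => omega
      | succ k hk ih =>
        rw [hrun.memory]
        have h1 := EdgeEvent.nextMemory_le (e := e k) (h := h) (p := p k) (M := M k) s
        have h2 := EdgeEvent.pend_le_max (e := e k) (p := p k) (M := M k) s
        have h3 := (he k (by omega)).level_le
        omega
    obtain ⟨k₂, hk₂, h1, h2, h3⟩ := frequently_atTop.1 htop (k₁ + 1)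
    have hreg := htopReg k₂ h1 h2 h3
    have hpo : ¬ Odd (p k₂) := by rwa [h1]
    have hc : c (k₂ + 1) = (c k₂).update (n + 1) s d := by
      rw [hrun.config, hreg, EdgeEvent.choosePrio_even hpo, h1]
    have hM : M (k₂ + 1) = (e k₂).pend (p k₂) (M k₂) := by
      rw [hrun.memory, EdgeEvent.nextMemory_even hpo]
    have hMs2 : M (k₂ + 1) s = 0 := by
      rw [hM]
      simp [EdgeEvent.pend, h1, h2, h3, hMd k₂ hk₂]
    -- After the top edge `r_s` is even, its counters below `d` are zero and nothing is owed: the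
    -- invariant starts afresh, whatever the past.
    have hI : (c (k₂ + 1)).Invariant n h d s (t (k₂ + 1)) (P (k₂ + 1)) (M (k₂ + 1)) := by
      refine ⟨habove _ (by omega), fun j hj hn => ?_, fun ho => ?_, fun _ x hx ho => ?_,
        fun hn => absurd hMs2 hn⟩
      · rw [hM, EdgeEvent.pend_of_lt (by omega)] at hn
        exact absurd rfl hn
      · rw [hc, RegConfig.reg_update_self] at ho
        exact absurd ho hdo
      · have hz : (c (k₂ + 1)).cnt x s = 0 := by
          rw [hc]; exact RegConfig.cnt_update_self_of_lt hx
        exact ⟨fun _ => by omega, fun _ => RegConfig.load_le.trans (by omega)⟩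
    refine eventually_atTop.2 ⟨k₂ + 1, fun k hk => ?_⟩
    have hIk := hrun.invariant_of_ge hs hv (fun k hk => he k (by omega)) hI k hk
    exact ⟨(hIk.step (N := n + 1) hs (hv k) (he k (by omega))).1, hIk.not_overflow (hv k)⟩
  -- With only even priorities left, debts are never paid; after a top edge the content of `r_s`
  -- stays even, which excludes an overflow.
  · rw [not_frequently] at hodd
    obtain ⟨K', hodd⟩ := eventually_atTop.1 hodd
    obtain ⟨k₂, hk₂, h1, h2, h3⟩ := frequently_atTop.1 htop (max K K')
    have hreg := htopReg k₂ h1 h2 h3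
    have hle : ∀ k ≥ k₂, (e k).chooseReg h (p k) (M k) ≤ s := fun k hk => by
      have h4 := (he k (by omega)).rank_le
      rw [EdgeEvent.chooseReg_even (hodd k (by omega))]
      split_ifs <;> omega
    have heven : ∀ k ≥ k₂ + 1, ¬ Odd ((c k).reg s) := fun k hk => by
      induction k, hk using Nat.le_induction with
      | base =>
        rw [hrun.config, hreg, EdgeEvent.choosePrio_even (hodd k₂ (by omega)), h1,
          RegConfig.reg_update_self]
        exact hdo
      | succ k hk ih =>
        have hpo := hodd k (by omega)
        rw [hrun.config, EdgeEvent.choosePrio_even hpo]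
        rcases (hle k (by omega)).eq_or_lt with h4 | h4
        · rw [h4, RegConfig.reg_update_self]
          exact hpo
        · rw [RegConfig.reg_update_of_lt h4]
          rcases max_choice (p k) ((c k).reg s) with h5 | h5 <;> rw [h5]
          · exact hpo
          · exact ih
    exact eventually_atTop.2
      ⟨k₂ + 1, fun k hk => ⟨hle k (by omega), fun hov => heven k hk hov.2.1⟩⟩

/-- Each top edge outputs `2 * s`; from some point on, smaller registers, even when they overflow,
and `r_s`, which does not, output at most that. -/
theorem parityAccepting (hrun : IsRun (n + 1) h e p c M) (hs1 : 1 ≤ s) (hs : s ≤ h)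
    (hv : ∀ k, RankedVertex n d (t k) (P k))
    (he : ∀ᶠ k in atTop, RankedEdge d s (e k) (p k) (t k) (t (k + 1)) (P k) (P (k + 1)))
    (htop : ∃ᶠ k in atTop, p k = d ∧ (e k).rank = s ∧ (e k).level = d) :
    ParityAccepting fun k => (c k).output (n + 1) ((e k).chooseReg h (p k) (M k)) := by
  have hev := hrun.exists_not_overflow hs hv he htop
  refine ⟨2 * s, even_two_mul s, ?_, ?_⟩
  · refine (htop.and_eventually (hev.and he)).mono fun k hk => ?_
    obtain ⟨⟨h1, h2, h3⟩, ⟨_, h4⟩, h5⟩ := hk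
    have ho : ¬ Odd (p k) := by
      rw [h1, ← h3]
      exact Nat.not_odd_iff_even.2 h5.level_even
    beta_reduce
    rw [EdgeEvent.chooseReg_even ho, if_pos (by omega), h2]
    exact RegConfig.output_eq hs1 h4
  · exact hev.mono fun k hk => RegConfig.output_le hs1 hk.1 hk.2

end IsRun

/-! ## Ranking an attractor decomposition -/

namespace OrdTree

theorem le_strahler_node (n : ℕ) {K : Type u} [LinearOrder K] [WellFoundedLT K]
    (child : K → OrdTree.{u}) (k : K) :
    (child k).strahler n ≤ (node K child).strahler n := by
  rw [strahler]
  have h : ¬ IsEmpty K := fun h => h.elim k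
  rw [if_neg h]
  have h1 : (child k).strahler n ≤ ⨆ k' : K, (child k').strahler n :=
    le_iSup (fun k' => (child k').strahler n) k
  split_ifs
  · exact h1.trans le_self_add
  · exact h1

theorem one_le_strahler (n : ℕ) (T : OrdTree.{u}) : 1 ≤ T.strahler n := by
  induction T with
  | node K child ih =>
    by_cases h : IsEmpty K
    · rw [strahler, if_pos h]
    · rw [not_isEmpty_iff] at h
      obtain ⟨k⟩ := h
      exact (ih k).trans (le_strahler_node n child k)

/-- At most `n` children have the same `n`-Strahler number as a node. -/
theorem encard_strahler_eq_le (n : ℕ) {K : Type u} [LinearOrder K] [WellFoundedLT K]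
    (child : K → OrdTree.{u}) (h : (node K child).strahler n ≠ ⊤) :
    {k : K | (child k).strahler n = (node K child).strahler n}.encard ≤ n := by
  by_cases hK : IsEmpty K
  · simp [Set.eq_empty_of_isEmpty]
  · rw [strahler, if_neg hK] at h ⊢
    -- If the number exceeds the supremum over the children, no child attains it; otherwise fewer
    -- than `n + 1` children do.
    split_ifs at h ⊢ with h1
    · have h2 : {k : K | (child k).strahler n = (⨆ k' : K, (child k').strahler n) + 1} = ∅ := by
        ext k
        simp only [Set.mem_ofPred_eq, Set.mem_empty_iff_false, iff_false]
        intro h3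
        have h4 : (child k).strahler n ≤ ⨆ k' : K, (child k').strahler n :=
          le_iSup (fun k' => (child k').strahler n) k
        rw [h3] at h4
        have h5 : (⨆ k' : K, (child k').strahler n) ≠ ⊤ := fun h6 => h (by rw [h6]; rfl)
        exact absurd h4 (not_le.2 ((ENat.lt_add_one_iff h5).2 le_rfl))
      rw [h2]
      simp
    · rw [not_le] at h1
      exact (ENat.lt_add_one_iff (ENat.natCast_ne_top n)).1 h1

end OrdTree

/-! ### Paths, attractors and rankings of graphs. -/

namespace ParityGraph

variable {X : Type u} {G : ParityGraph X}

theorem isPathFrom_cons {x y : X} {ρ : ℕ → X} (h : G.Adj x y) (hρ : G.IsPathFrom y ρ) :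
    G.IsPathFrom x (fun k => Nat.casesOn k x ρ) := by
  refine ⟨rfl, fun k => ?_⟩
  cases k with
  | zero => simpa [hρ.1] using h
  | succ k => exact hρ.2 k

/-- A path from `y` that avoids `F`, preceded by the edge from `x`, would avoid `F` too. -/
theorem attrEdges_of_adj {F : X → X → Prop} {x y : X} (hx : x ∈ G.attrEdges F) (h : G.Adj x y)
    (hF : ¬ F x y) : y ∈ G.attrEdges F := by
  refine ⟨(G.adj_mem h).2, fun ρ hρ => ?_⟩
  obtain ⟨k, hk⟩ := hx.2 _ (isPathFrom_cons h hρ)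
  cases k with
  | zero =>
    simp only [hρ.1] at hk
    exact absurd hk hF
  | succ k => exact ⟨k, hk⟩

theorem attrVerts_of_adj {S : Set X} {x y : X} (hx : x ∈ G.attrVerts S) (h : G.Adj x y)
    (hS : x ∉ S) : y ∈ G.attrVerts S := by
  refine ⟨(G.adj_mem h).2, .inr fun ρ hρ => ?_⟩
  obtain ⟨k, hk⟩ := (hx.2.resolve_left hS) _ (isPathFrom_cons h hρ)
  cases k with
  | zero => exact absurd hk hS
  | succ k => exact ⟨k, hk⟩

theorem isPathFrom_shift {ρ : ℕ → X} {K : ℕ} (hρ : ∀ k ≥ K, G.Adj (ρ k) (ρ (k + 1))) :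
    G.IsPathFrom (ρ K) (fun k => ρ (K + k)) :=
  ⟨rfl, fun k => hρ (K + k) (by omega)⟩

/-- A ranking of a graph of level `d` and Strahler number `s`: every edge gets an event, and every
infinite path eventually stays in a subgraph that is ranked and sees its top priority again and
again. -/
structure Ranking (G : ParityGraph X) (n d s : ℕ) (ev : X → X → EdgeEvent) (t : X → ℕ)
    (P : X → ℕ → ℕ) : Prop where
  -- Demanded of all pairs, since Eve's strategy must be legal also after histories that are not
  -- consistent with `σ`.
  event : ∀ x y, 1 ≤ (ev x y).rank ∧ (ev x y).rank ≤ s ∧ Even (ev x y).level ∧ (ev x y).level ≤ d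
  vertex : ∀ x, RankedVertex n d (t x) (P x)
  edge : ∀ x y, G.Adj x y → RankedEdge d s (ev x y) (G.label x y) (t x) (t y) (P x) (P y)
  path : ∀ ρ : ℕ → X, (∀ k, G.Adj (ρ k) (ρ (k + 1))) →
    ∃ (d' s' : ℕ) (t' : X → ℕ) (P' : X → ℕ → ℕ), (∀ x, RankedVertex n d' (t' x) (P' x)) ∧
      (∀ᶠ k in atTop, RankedEdge d' s' (ev (ρ k) (ρ (k + 1))) (G.label (ρ k) (ρ (k + 1)))
        (t' (ρ k)) (t' (ρ (k + 1))) (P' (ρ k)) (P' (ρ (k + 1)))) ∧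
      ∃ᶠ k in atTop, G.label (ρ k) (ρ (k + 1)) = d' ∧
        (ev (ρ k) (ρ (k + 1))).rank = s' ∧ (ev (ρ k) (ρ (k + 1))).level = d'

theorem frequently_of_attrEdges {F : X → X → Prop} {ρ : ℕ → X}
    (hρ : ∀ k, G.Adj (ρ k) (ρ (k + 1))) (h : ∃ᶠ k in atTop, ρ k ∈ G.attrEdges F) :
    ∃ᶠ k in atTop, F (ρ k) (ρ (k + 1)) := by
  rw [frequently_atTop] at h ⊢
  intro a
  obtain ⟨b, hb, h⟩ := h a
  obtain ⟨k, hk⟩ := h.2 _ (isPathFrom_shift fun k _ => hρ k)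
  exact ⟨b + k, by omega, hk⟩

/-- With no children to pass, constant levels and zero counts suffice, and every path returns to the
top priority because it never leaves its attractor. -/
theorem exists_ranking_of_cover {n m s : ℕ} (prio_le : G.PrioritiesLE (2 * m))
    (cover : G.verts = G.attrEdges (G.edgesOf (2 * m))) (hs : 1 ≤ s) :
    ∃ ev t P, G.Ranking n (2 * m) s ev t P := by
  have hv : ∀ x : X, RankedVertex n (2 * m) (2 * m) fun _ => 0 := fun _ =>
    ⟨even_two_mul m, le_rfl, fun _ => Nat.zero_le _⟩
  have he : ∀ x y, G.Adj x y → RankedEdge (2 * m) s ⟨s, 2 * m, False⟩ (G.label x y) (2 * m)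
      (2 * m) (fun _ => 0) (fun _ => 0) := fun x y h =>
    { rank_pos := hs
      rank_le := le_rfl
      level_even := even_two_mul m
      level_le := le_rfl
      prio_le := prio_le x y h
      below := fun h => absurd h (lt_irrefl _)
      top := fun _ _ => ⟨le_rfl, le_rfl, fun _ _ _ => le_rfl⟩
      leave := fun _ _ h => h.elim
      stay := fun _ _ _ => ⟨rfl, le_rfl, fun _ _ => le_rfl⟩ }
  refine ⟨fun _ _ => ⟨s, 2 * m, False⟩, fun _ => 2 * m, fun _ _ => 0,
    fun _ _ => ⟨hs, le_rfl, even_two_mul m, le_rfl⟩, hv, he, fun ρ hρ =>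
    ⟨2 * m, s, fun _ => 2 * m, fun _ _ => 0, hv, .of_forall fun k => he _ _ (hρ k), ?_⟩⟩
  refine (frequently_of_attrEdges (F := G.edgesOf (2 * m)) hρ (.of_forall fun k => ?_)).mono
    fun k hk => ⟨hk.2, rfl, rfl⟩
  rw [← cover]
  exact (G.adj_mem (hρ k)).1

/-- The sets `S k` and their attractors `A k` at a node of an attractor decomposition of `G` of
level `d`. -/
structure NodeSets {K : Type u} [LinearOrder K] (G : ParityGraph X) (d : ℕ) (S A : K → Set X) :
    Prop where
  subset : ∀ k, S k ⊆ G.remaining d A k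
  closed : ∀ k, ∀ x ∈ S k, ∀ y, (G.remainingGraph d A k).Adj x y → y ∈ S k
  attr : ∀ k, A k = (G.remainingGraph d A k).attrVerts (S k)
  cover : G.verts = G.attrEdges (G.edgesOf d) ∪ ⋃ k, A k

/-! ### Combining the rankings of the children of a node. -/

namespace NodeSets

variable {X : Type u} {G : ParityGraph X} {K : Type u} [LinearOrder K] {d : ℕ} {S A : K → Set X}

theorem subset_attr (hN : G.NodeSets d S A) (k : K) : S k ⊆ A k := fun x hx => by
  rw [hN.attr k]
  exact ⟨⟨(hN.subset k hx).1, hN.subset k hx⟩, .inl hx⟩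

theorem mem_remaining (hN : G.NodeSets d S A) {k : K} {x : X} (hx : x ∈ A k) :
    x ∈ G.remaining d A k := by
  rw [hN.attr k] at hx
  exact hx.1.2

theorem notMem_attrEdges (hN : G.NodeSets d S A) {k : K} {x : X} (hx : x ∈ A k) :
    x ∉ G.attrEdges (G.edgesOf d) := fun h => (hN.mem_remaining hx).2 (.inl h)

theorem notMem_of_lt (hN : G.NodeSets d S A) {j k : K} {x : X} (hx : x ∈ A k) (hjk : j < k) :
    x ∉ A j := fun h => (hN.mem_remaining hx).2 (.inr (Set.mem_iUnion.2 ⟨⟨j, hjk⟩, h⟩))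

theorem index_unique (hN : G.NodeSets d S A) {j k : K} {x : X} (hj : x ∈ A j) (hk : x ∈ A k) :
    j = k := by
  rcases lt_trichotomy j k with h | h | h
  · exact absurd hj (hN.notMem_of_lt hk h)
  · exact h
  · exact absurd hk (hN.notMem_of_lt hj h)

theorem remaining_anti {j k : K} (hjk : j ≤ k) : G.remaining d A k ⊆ G.remaining d A j := by
  rintro x ⟨h1, h2⟩
  refine ⟨h1, fun h => h2 (h.imp id fun h => ?_)⟩
  obtain ⟨i, hi⟩ := Set.mem_iUnion.1 h
  exact Set.mem_iUnion.2 ⟨⟨i.1, i.2.trans_le hjk⟩, hi⟩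

/-- Edges of priority other than `d` do not lead to attractors of larger index, nor out of `S k`
inside `A k`. -/
theorem index_le (hN : G.NodeSets d S A) {j k : K} {x y : X} (h : G.Adj x y)
    (hd : G.label x y ≠ d) (hx : x ∈ A k) (hy : y ∈ A j) : j ≤ k := by
  by_contra hlt
  push Not at hlt
  have hadj : (G.remainingGraph d A k).Adj x y :=
    ⟨⟨h, hd⟩, hN.mem_remaining hx, remaining_anti hlt.le (hN.mem_remaining hy)⟩
  refine hN.notMem_of_lt hy hlt ?_
  by_cases hS : x ∈ S k
  · exact hN.subset_attr k (hN.closed k x hS y hadj)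
  · rw [hN.attr k] at hx ⊢
    exact attrVerts_of_adj hx hadj hS

theorem mem_of_adj (hN : G.NodeSets d S A) {k : K} {x y : X} (h : G.Adj x y)
    (hd : G.label x y ≠ d) (hx : x ∈ S k) (hy : y ∈ A k) : y ∈ S k :=
  hN.closed k x hx y ⟨⟨h, hd⟩, hN.subset k hx, hN.mem_remaining hy⟩

theorem attrEdges_of_adj (h : G.Adj x y) (hd : G.label x y ≠ d)
    (hx : x ∈ G.attrEdges (G.edgesOf d)) : y ∈ G.attrEdges (G.edgesOf d) :=
  ParityGraph.attrEdges_of_adj hx h fun hF => hd hF.2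

/-- The indices in `T` that were passed when `x` is reached. -/
def passed (A : K → Set X) (T : Set K) (x : X) : Set K := {k ∈ T | ∀ j ≥ k, x ∉ A j}

/-- Indices never increase along such edges, and the attractor of the top edges, where all of `T`
counts as passed, is not left. -/
theorem passed_mono (hN : G.NodeSets d S A) (T : Set K) {x y : X} (h : G.Adj x y)
    (hd : G.label x y ≠ d) : passed A T x ⊆ passed A T y := by
  rintro k ⟨hk, hx⟩
  refine ⟨hk, fun j hj hy => ?_⟩
  have hxv : x ∈ G.attrEdges (G.edgesOf d) ∪ ⋃ k, A k := hN.cover ▸ (G.adj_mem h).1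
  rcases hxv with h1 | h1
  · exact hN.notMem_attrEdges hy (attrEdges_of_adj h hd h1)
  · obtain ⟨i, hi⟩ := Set.mem_iUnion.1 h1
    exact hx i (hj.trans (hN.index_le h hd hi hy)) hi

theorem passed_eq (hN : G.NodeSets d S A) (T : Set K) {k : K} {x y : X} (hx : x ∈ A k)
    (hy : y ∈ A k) : passed A T x = passed A T y := by
  have : ∀ j, x ∈ A j ↔ y ∈ A j := fun j =>
    ⟨fun h => hN.index_unique hx h ▸ hy, fun h => hN.index_unique hy h ▸ hx⟩
  simp only [passed, this]

theorem mem_passed (hN : G.NodeSets d S A) {T : Set K} {k : K} {x y : X} (h : G.Adj x y)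
    (hd : G.label x y ≠ d) (hk : k ∈ T) (hx : x ∈ S k) (hy : y ∉ S k) : k ∈ passed A T y := by
  refine ⟨hk, fun j hj hyj => ?_⟩
  have hjk := hN.index_le h hd (hN.subset_attr k hx) hyj
  obtain rfl := le_antisymm hjk hj
  exact hy (hN.mem_of_adj h hd hx hyj)

theorem notMem_passed (hN : G.NodeSets d S A) {T : Set K} {k : K} {x : X} (hx : x ∈ S k) :
    k ∉ passed A T x := fun h => h.2 k le_rfl (hN.subset_attr k hx)

/-- An infinite path with finitely many edges of priority `d` stays in some `S k` eventually. -/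
theorem exists_eventually_mem [WellFoundedLT K] (hN : G.NodeSets d S A) {ρ : ℕ → X}
    (hρ : ∀ k, G.Adj (ρ k) (ρ (k + 1))) (hd : ∀ᶠ k in atTop, G.label (ρ k) (ρ (k + 1)) ≠ d) :
    ∃ i K₀, ∀ k ≥ K₀, ρ k ∈ S i ∧ G.label (ρ k) (ρ (k + 1)) ≠ d := by
  have hA : ∀ᶠ k in atTop, ρ k ∉ G.attrEdges (G.edgesOf d) := by
    by_contra h
    rw [← Filter.Frequently] at h
    exact frequently_of_attrEdges hρ h (hd.mono fun k hk hF => hk hF.2)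
  obtain ⟨a, ha⟩ := eventually_atTop.1 (hd.and hA)
  have hidx : ∀ k ≥ a, ∃ i, ρ k ∈ A i := fun k hk => by
    have hv : ρ k ∈ G.attrEdges (G.edgesOf d) ∪ ⋃ k, A k := hN.cover ▸ (G.adj_mem (hρ k)).1
    exact Set.mem_iUnion.1 (hv.resolve_left (ha k hk).2)
  -- The least index visited is never left, since indices cannot increase again.
  obtain ⟨i, ⟨b, hb, hbi⟩, hmin⟩ := wellFounded_lt.has_min {i | ∃ k ≥ a, ρ k ∈ A i}
    (by obtain ⟨i, hi⟩ := hidx a le_rfl; exact ⟨i, a, le_rfl, hi⟩)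
  have hstay : ∀ k ≥ b, ρ k ∈ A i := fun k hk => by
    induction k, hk using Nat.le_induction with
    | base => exact hbi
    | succ k hk ih =>
      obtain ⟨j, hj⟩ := hidx (k + 1) (by omega)
      have hji := hN.index_le (hρ k) (ha k (by omega)).1 ih hj
      rcases hji.lt_or_eq with h | rfl
      · exact absurd h (hmin j ⟨k + 1, by omega, hj⟩)
      · exact hj
  have hadj : ∀ k ≥ b, (G.remainingGraph d A i).Adj (ρ k) (ρ (k + 1)) := fun k hk =>
    ⟨⟨hρ k, (ha k (by omega)).1⟩, hN.mem_remaining (hstay k hk),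
      hN.mem_remaining (hstay (k + 1) (by omega))⟩
  have hvisit : ∃ l ≥ b, ρ l ∈ S i := by
    have := hbi
    rw [hN.attr i] at this
    rcases this.2 with h | h
    · exact ⟨b, le_rfl, h⟩
    · obtain ⟨k, hk⟩ := h _ (isPathFrom_shift hadj)
      exact ⟨b + k, by omega, hk⟩
  obtain ⟨l, hl, hlS⟩ := hvisit
  refine ⟨i, l, fun k hk => ⟨?_, (ha k (by omega)).1⟩⟩
  induction k, hk using Nat.le_induction with
  | base => exact hlS
  | succ k hk ih => exact hN.closed i _ ih _ (hadj k (by omega))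

section Ranking

variable {n m s : ℕ} {sk : K → ℕ} {ev : K → X → X → EdgeEvent} {t : K → X → ℕ}
  {P : K → X → ℕ → ℕ}

open Classical in
/-- The events at a node, given the events of its children. -/
noncomputable def event (G : ParityGraph X) (d s : ℕ) (S : K → Set X) (sk : K → ℕ)
    (ev : K → X → X → EdgeEvent) (x y : X) : EdgeEvent :=
  if h : G.label x y ≠ d ∧ ∃ k, x ∈ S k ∧ y ∈ S k then ev h.2.choose x y
  else ⟨s, d, ∃ k, sk k = s ∧ x ∈ S k⟩

open Classical in
/-- The levels at a node, given the levels of its children. -/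
noncomputable def level (d s : ℕ) (S : K → Set X) (sk : K → ℕ) (t : K → X → ℕ) (x : X) : ℕ :=
  if h : ∃ k, sk k = s ∧ x ∈ S k then t h.choose x else d

open Classical in
/-- The counts at a node, given the counts of its children. -/
noncomputable def count (m s : ℕ) (S A : K → Set X) (sk : K → ℕ) (P : K → X → ℕ → ℕ) (x : X)
    (z : ℕ) : ℕ :=
  -- Values below `2 * m` belong to nodes inside a child; `2 * m + 1` is the only other odd value
  -- below the level `2 * (m + 1)` and counts the children of this node.
  if z < 2 * m then (if h : ∃ k, sk k = s ∧ x ∈ S k then P h.choose x z else 0)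
  else (passed A {k | sk k = s} x).ncard

theorem event_of_mem (hN : G.NodeSets d S A) {k : K} {x y : X} (hd : G.label x y ≠ d)
    (hx : x ∈ S k) (hy : y ∈ S k) : event G d s S sk ev x y = ev k x y := by
  have h : G.label x y ≠ d ∧ ∃ k, x ∈ S k ∧ y ∈ S k := ⟨hd, k, hx, hy⟩
  rw [event, dif_pos h, hN.index_unique (hN.subset_attr _ h.2.choose_spec.1)
    (hN.subset_attr k hx)]

theorem level_of_mem (hN : G.NodeSets d S A) {k : K} {x : X} (hk : sk k = s) (hx : x ∈ S k) :
    level d s S sk t x = t k x := by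
  have h : ∃ k, sk k = s ∧ x ∈ S k := ⟨k, hk, hx⟩
  rw [level, dif_pos h, hN.index_unique (hN.subset_attr _ h.choose_spec.2) (hN.subset_attr k hx)]

theorem count_of_mem (hN : G.NodeSets d S A) {k : K} {x : X} (hk : sk k = s) (hx : x ∈ S k)
    {z : ℕ} (hz : z < 2 * m) : count m s S A sk P x z = P k x z := by
  have h : ∃ k, sk k = s ∧ x ∈ S k := ⟨k, hk, hx⟩
  rw [count, if_pos hz, dif_pos h, hN.index_unique (hN.subset_attr _ h.choose_spec.2)
    (hN.subset_attr k hx)]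

theorem count_of_le {x : X} {z : ℕ} (hz : 2 * m ≤ z) :
    count m s S A sk P x z = (passed A {k | sk k = s} x).ncard := by
  rw [count, if_neg (by omega)]

theorem count_of_notMem {x : X} (hx : ¬ ∃ k, sk k = s ∧ x ∈ S k) {z : ℕ} (hz : z < 2 * m) :
    count m s S A sk P x z = 0 := by
  rw [count, if_pos hz, dif_neg hx]

/-- The rankings of the children of a node give a ranking of the node. -/
theorem ranking [WellFoundedLT K] (hN : G.NodeSets (2 * (m + 1)) S A)
    (prio_le : G.PrioritiesLE (2 * (m + 1))) (hs : 1 ≤ s) (hsk : ∀ k, sk k ≤ s)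
    (hcard : {k | sk k = s}.encard ≤ n)
    (hR : ∀ k, ((G.deletePriority (2 * (m + 1))).restrict (S k)).Ranking n (2 * m) (sk k)
      (ev k) (t k) (P k)) :
    G.Ranking n (2 * (m + 1)) s (event G (2 * (m + 1)) s S sk ev)
      (level (2 * (m + 1)) s S sk t) (count m s S A sk P) := by
  have hfin : {k | sk k = s}.Finite := Set.finite_of_encard_le_coe hcard
  have hTn : {k | sk k = s}.ncard ≤ n := by
    rw [← hfin.cast_ncard_eq] at hcard
    exact_mod_cast hcard
  have hpfin : ∀ x, (passed A {k | sk k = s} x).Finite := fun x => hfin.subset fun k hk => hk.1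
  have hlev : ∀ x, level (2 * (m + 1)) s S sk t x ≤ 2 * (m + 1) := fun x => by
    unfold level
    split_ifs with h
    · exact ((hR _).vertex x).le.trans (by omega)
    · exact le_rfl
  have hvertex : ∀ x, RankedVertex n (2 * (m + 1)) (level (2 * (m + 1)) s S sk t x)
      (count m s S A sk P x) := fun x => by
    refine ⟨?_, hlev x, fun z => ?_⟩
    · unfold level
      split_ifs with h
      · exact ((hR _).vertex x).even
      · exact even_two_mul _
    · unfold count
      split_ifs with h1 h2
      · exact ((hR _).vertex x).count_le z
      · exact Nat.zero_le n
      · exact (Set.ncard_le_ncard (fun k hk => hk.1) hfin).trans hTn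
  have hedge : ∀ x y, G.Adj x y → RankedEdge (2 * (m + 1)) s (event G (2 * (m + 1)) s S sk ev x y)
      (G.label x y) (level (2 * (m + 1)) s S sk t x) (level (2 * (m + 1)) s S sk t y)
      (count m s S A sk P x) (count m s S A sk P y) := by
    intro x y h
    by_cases hd : G.label x y = 2 * (m + 1)
    · have hev : event G (2 * (m + 1)) s S sk ev x y =
          ⟨s, 2 * (m + 1), ∃ k, sk k = s ∧ x ∈ S k⟩ := dif_neg fun h => h.1 hd
      rw [hev]
      exact
        { rank_pos := hs
          rank_le := le_rfl
          level_even := even_two_mul _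
          level_le := le_rfl
          prio_le := prio_le x y h
          below := fun h => absurd h (lt_irrefl _)
          top := fun _ _ => ⟨hlev x, hlev y, fun z h1 h2 => absurd h1 h2.not_gt⟩
          leave := fun _ h => absurd hd h
          stay := fun _ h => absurd hd h }
    by_cases hS : ∃ k, x ∈ S k ∧ y ∈ S k
    · obtain ⟨k, hx, hy⟩ := hS
      have hk := (hR k).edge x y ⟨⟨h, hd⟩, hx, hy⟩
      rw [hN.event_of_mem hd hx hy]
      have hpass := hN.passed_eq {k | sk k = s} (hN.subset_attr k hx) (hN.subset_attr k hy)
      have hlabel : ((G.deletePriority (2 * (m + 1))).restrict (S k)).label x y = G.label x y := rfl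
      rw [hlabel] at hk
      by_cases hks : sk k = s
      · rw [hN.level_of_mem hks hx, hN.level_of_mem hks hy]
        -- `q` is the range on which the child compares its counts. From `2 * m` on the counts
        -- agree, as both end points lie in the same attractor.
        have hP : ∀ {q : ℕ → Prop}, (∀ z < 2 * m, q z → P k x z ≤ P k y z) → ∀ z, q z →
            count m s S A sk P x z ≤ count m s S A sk P y z := fun hq z hz => by
          rcases lt_or_ge z (2 * m) with h1 | h1
          · rw [hN.count_of_mem hks hx h1, hN.count_of_mem hks hy h1]
            exact hq z h1 hz
          · rw [count_of_le h1, count_of_le h1, hpass]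
        rw [hks] at hk
        have hkl := hk.level_le
        exact
          { rank_pos := hk.rank_pos
            rank_le := hk.rank_le
            level_even := hk.level_even
            level_le := hk.level_le.trans (by omega)
            prio_le := hk.prio_le
            below := fun h1 => by
              obtain ⟨h2, h3, h4⟩ := hk.below h1
              exact ⟨h2, h3, fun z _ => hP (q := fun _ => True) (fun z hz _ => h4 z hz) z trivial⟩
            top := fun h1 h2 => by
              obtain ⟨h3, h4, h5⟩ := hk.top h1 h2
              exact ⟨h3, h4, fun z _ => hP h5 z⟩
            leave := fun h1 h2 h3 => by
              obtain ⟨h4, h5, h6, h7⟩ := hk.leave h1 h2 h3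
              refine ⟨h4, h5, ?_, fun z _ => hP h7 z⟩
              rwa [hN.count_of_mem hks hx (by omega), hN.count_of_mem hks hy (by omega)]
            stay := fun h1 h2 h3 => by
              obtain ⟨h4, h5, h6⟩ := hk.stay h1 h2 h3
              exact ⟨h4, h5, fun z _ => hP (q := fun _ => True) (fun z hz _ => h6 z hz) z trivial⟩ }
      -- A child of smaller number is invisible here: the level is that of the node and the counts
      -- do not change.
      · have hlt : sk k < s := lt_of_le_of_ne (hsk k) hks
        have hnot : ∀ z ∈ S k, ¬ ∃ k, sk k = s ∧ z ∈ S k := by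
          rintro z hz ⟨j, hj, hzj⟩
          rw [hN.index_unique (hN.subset_attr j hzj) (hN.subset_attr k hz)] at hj
          exact hks hj
        have hlx : level (2 * (m + 1)) s S sk t x = 2 * (m + 1) := dif_neg (hnot x hx)
        have hly : level (2 * (m + 1)) s S sk t y = 2 * (m + 1) := dif_neg (hnot y hy)
        rw [hlx, hly]
        have hkl := hk.level_le
        have hrk := hk.rank_le
        exact
          { rank_pos := hk.rank_pos
            rank_le := hk.rank_le.trans (hsk k)
            level_even := hk.level_even
            level_le := hk.level_le.trans (by omega)
            prio_le := hk.prio_le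
            below := fun _ => ⟨by omega, rfl, fun z _ => by
              rcases lt_or_ge z (2 * m) with h1 | h1
              · rw [count_of_notMem (hnot x hx) h1]
                exact Nat.zero_le _
              · rw [count_of_le h1, count_of_le h1, hpass]⟩
            top := fun h1 => by omega
            leave := fun h1 => by omega
            stay := fun h1 => by omega }
    · have hev : event G (2 * (m + 1)) s S sk ev x y =
          ⟨s, 2 * (m + 1), ∃ k, sk k = s ∧ x ∈ S k⟩ := dif_neg fun h => hS h.2
      rw [hev]
      exact
        { rank_pos := hs
          rank_le := le_rfl
          level_even := even_two_mul _
          level_le := le_rfl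
          prio_le := prio_le x y h
          below := fun h => absurd h (lt_irrefl _)
          top := fun _ h => absurd h hd
          leave := by
            rintro - - ⟨k, hk, hx⟩
            have hy : y ∉ S k := fun hy => hS ⟨k, hx, hy⟩
            refine ⟨?_, hlev y, ?_, fun z h1 h2 => absurd h1 (not_lt.2 h2)⟩
            · rw [hN.level_of_mem hk hx]
              have := ((hR k).vertex x).le
              show _ < 2 * (m + 1)
              omega
            · show count m s S A sk P x (2 * (m + 1) - 1) + 1 ≤
                count m s S A sk P y (2 * (m + 1) - 1)
              rw [count_of_le (by omega), count_of_le (by omega)]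
              -- The index `k` of the child just left is newly passed.
              refine Set.ncard_lt_ncard ?_ (hpfin y)
              refine (Set.ssubset_iff_of_subset (hN.passed_mono _ h hd)).2
                ⟨k, hN.mem_passed h hd hk hx hy, hN.notMem_passed hx⟩
          stay := fun _ _ hx => ⟨dif_neg hx, hlev y, fun z hz => by
            rcases lt_or_ge z (2 * m) with h1 | h1
            · rw [count_of_notMem hx h1]
              exact Nat.zero_le _
            · rw [count_of_le h1, count_of_le h1]
              exact Set.ncard_le_ncard (hN.passed_mono _ h hd) (hpfin y)⟩ }
  refine ⟨fun x y => ?_, hvertex, hedge, fun ρ hρ => ?_⟩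
  · unfold event
    split_ifs with h
    · obtain ⟨h1, h2, h3, h4⟩ := (hR h.2.choose).event x y
      exact ⟨h1, h2.trans (hsk _), h3, h4.trans (by omega)⟩
    · exact ⟨hs, le_rfl, even_two_mul _, le_rfl⟩
  · by_cases hfreq : ∃ᶠ k in atTop, G.label (ρ k) (ρ (k + 1)) = 2 * (m + 1)
    · refine ⟨_, s, _, _, hvertex, .of_forall fun k => hedge _ _ (hρ k), hfreq.mono fun k hk => ?_⟩
      have hev : event G (2 * (m + 1)) s S sk ev (ρ k) (ρ (k + 1)) =
          ⟨s, 2 * (m + 1), ∃ i, sk i = s ∧ ρ k ∈ S i⟩ := dif_neg fun h => h.1 hk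
      rw [hev]
      exact ⟨hk, rfl, rfl⟩
    -- The path ends up in a single `S i`, on which the events are those of the child; the witnesses
    -- of the child serve again, up to a shift by `K₀`.
    · rw [not_frequently] at hfreq
      obtain ⟨i, K₀, hi⟩ := hN.exists_eventually_mem hρ hfreq
      obtain ⟨d', s', t', P', h1, h2, h3⟩ := (hR i).path (fun k => ρ (k + K₀)) fun k => by
        have h4 := hi (k + K₀) (by omega)
        have h5 := hi (k + 1 + K₀) (by omega)
        have : k + 1 + K₀ = k + K₀ + 1 := by omega
        simp only [this] at h5 ⊢
        exact ⟨⟨hρ _, h4.2⟩, h4.1, h5.1⟩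
      have hev : ∀ k ≥ K₀, event G (2 * (m + 1)) s S sk ev (ρ k) (ρ (k + 1)) =
          ev i (ρ k) (ρ (k + 1)) := fun k hk =>
        hN.event_of_mem (hi k hk).2 (hi k hk).1 (hi (k + 1) (by omega)).1
      refine ⟨d', s', t', P', h1, ?_, ?_⟩
      · obtain ⟨b, hb⟩ := eventually_atTop.1 h2
        refine eventually_atTop.2 ⟨b + K₀, fun k hk => ?_⟩
        have h4 := hb (k - K₀) (by omega)
        rw [hev k (by omega)]
        have h5 : k - K₀ + K₀ = k := by omega
        have h6 : k - K₀ + 1 + K₀ = k + 1 := by omega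
        simp only [h5, h6] at h4
        exact h4
      · rw [frequently_atTop] at h3 ⊢
        intro a
        obtain ⟨k, hk, h4⟩ := h3 a
        refine ⟨k + K₀, by omega, ?_⟩
        rw [hev (k + K₀) (by omega)]
        have h6 : k + 1 + K₀ = k + K₀ + 1 := by omega
        simp only [h6] at h4
        exact h4

end Ranking

end NodeSets
end ParityGraph

/-- An attractor decomposition with finite Strahler number induces a ranking. -/
theorem AttractorDecomposition.exists_ranking {X : Type u} {G : ParityGraph X} {m : ℕ} (n : ℕ)
    (D : AttractorDecomposition G m) (s : ℕ) (hD : D.treeShape.strahler n = (s : ℕ∞)) :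
    ∃ ev t P, G.Ranking n (2 * m) s ev t P := by
  induction D generalizing s with
  | leaf G m prio_le cover =>
    refine ParityGraph.exists_ranking_of_cover prio_le cover ?_
    have := OrdTree.one_le_strahler n (AttractorDecomposition.leaf G m prio_le cover).treeShape
    rw [hD] at this
    exact_mod_cast this
  | node G m prio_le K S A S_nonempty S_subset S_prio_le S_noTerminal S_closed A_eq D cover ih =>
    rw [treeShape] at hD
    have h1 := OrdTree.one_le_strahler n (OrdTree.node K fun k => (D k).treeShape)
    have h2 := OrdTree.le_strahler_node n fun k => (D k).treeShape
    have h3 := OrdTree.encard_strahler_eq_le n (fun k => (D k).treeShape)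
      (by rw [hD]; exact ENat.natCast_ne_top s)
    rw [hD] at h1 h2 h3
    -- The number of a child is bounded by the finite number `s` of the node.
    have h4 : ∀ k, ∃ r : ℕ, (D k).treeShape.strahler n = r := fun k => by
      obtain ⟨r, hr⟩ := ENat.ne_top_iff_exists.1
        (ne_top_of_le_ne_top (ENat.natCast_ne_top s) (h2 k))
      exact ⟨r, hr.symm⟩
    choose sk hsk using h4
    choose ev t P hR using fun k => ih k (sk k) (hsk k)
    have hN : G.NodeSets (2 * (m + 1)) S A := ⟨S_subset, S_closed, A_eq, cover⟩
    simp only [hsk, Nat.cast_inj, Nat.cast_le] at h2 h3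
    exact ⟨_, _, _, hN.ranking prio_le (by exact_mod_cast h1) h2 h3 hR⟩

/-! ## The winning strategy -/

namespace ParityGame

variable {V : Type u} {I : Finset ℕ} {G : ParityGame V I} {v₀ : V}

/-- The play in `G` that underlies a play of the transduction game. -/
def playOf (v₀ : V) (l : List (RegRound V)) : List V := l.map RegRound.pos ++ [v₀]

theorem exists_playOf_eq (l : List (RegRound V)) :
    ∃ past, playOf v₀ l = currentPos v₀ l :: past := by
  cases l with
  | nil => exact ⟨[], rfl⟩
  | cons r l => exact ⟨playOf v₀ l, rfl⟩

/-- The pending levels after a play of the transduction game. -/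
noncomputable def pendingLevels (G : ParityGame V I) (h : ℕ) (ev : List V → List V → EdgeEvent)
    (v₀ : V) : List (RegRound V) → ℕ → ℕ
  | [] => fun _ => 0
  | r :: l => (ev (playOf v₀ l) (r.pos :: playOf v₀ l)).nextMemory h
      (G.label (currentPos v₀ l) r.pos) (pendingLevels G h ev v₀ l)

section Strategy

variable {h m : ℕ} {ev : List V → List V → EdgeEvent}

/-- As `2 * m - 1 ≤ b`, a debt is a legal update priority. -/
theorem pendingLevels_le (hev : ∀ x y, (ev x y).level ≤ 2 * m) (l : List (RegRound V)) (j : ℕ) :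
    G.pendingLevels h ev v₀ l j ≤ 2 * m - 1 := by
  induction l with
  | nil => exact Nat.zero_le _
  | cons r l ih =>
    refine (EdgeEvent.nextMemory_le j).trans ((EdgeEvent.pend_le_max j).trans (max_le ih ?_))
    exact Nat.sub_le_sub_right (hev _ _) 1

theorem pendingLevels_eq_zero_or_odd (hev : ∀ x y, Even (ev x y).level) (l : List (RegRound V))
    (j : ℕ) : G.pendingLevels h ev v₀ l j = 0 ∨ Odd (G.pendingLevels h ev v₀ l j) := by
  induction l with
  | nil => exact .inl rfl
  | cons r l ih => exact EdgeEvent.nextMemory_eq_zero_or_odd (hev _ _) ih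

theorem isRegister_of_le {j : ℕ} (h1 : 1 ≤ h) (hj : j ≤ h) :
    IsRegister (Finset.Icc 1 (2 * h)) j := by
  rcases Nat.eq_zero_or_pos j with rfl | h0
  · exact .inr ⟨rfl, Finset.mem_Icc.2 (by omega)⟩
  · exact .inl (Finset.mem_Icc.2 (by omega))

/-- Eve's strategy in the transduction game: she follows `σ` in `G`, and `ev` for the registers. -/
noncomputable def regStrategy {a b : ℕ} {G : ParityGame V (Finset.Icc a b)} (σ : G.Strategy)
    (v₀ : V) (h1 : 1 ≤ h) (hm : 2 * m ≤ b + 1)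
    (hev : ∀ x y, (ev x y).rank ≤ h ∧ Even (ev x y).level ∧ (ev x y).level ≤ 2 * m) :
    G.RegStrategy (Finset.Icc 1 (2 * h)) v₀ where
  move l := σ.next (playOf v₀ l)
  move_legal l hl := by
    obtain ⟨past, hp⟩ := exists_playOf_eq (v₀ := v₀) l
    rw [hp]
    exact σ.legal _ _ hl
  reg l w := (ev (playOf v₀ l) (w :: playOf v₀ l)).chooseReg h (G.label (currentPos v₀ l) w)
    (G.pendingLevels h ev v₀ l)
  reg_legal l w _ := isRegister_of_le h1 (EdgeEvent.chooseReg_le (hev _ _).1)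
  prio l w := (ev (playOf v₀ l) (w :: playOf v₀ l)).choosePrio h (G.label (currentPos v₀ l) w)
    (G.pendingLevels h ev v₀ l)
  prio_legal l w hw := by
    by_cases hp : Odd (G.label (currentPos v₀ l) w)
    · have hI := Finset.mem_Icc.1 (G.label_mem hw)
      rw [EdgeEvent.choosePrio_odd hp]
      set e := ev (playOf v₀ l) (w :: playOf v₀ l)
      set p := G.label (currentPos v₀ l) w
      set M := G.pendingLevels h ev v₀ l
      have hodd : e.pend p M (e.chooseReg h p M) = 0 ∨ Odd (e.pend p M (e.chooseReg h p M)) :=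
        EdgeEvent.pend_eq_zero_or_odd (hev _ _).2.1
          (pendingLevels_eq_zero_or_odd (fun x y => (hev x y).2.1) l _)
      have hle : e.pend p M (e.chooseReg h p M) ≤ 2 * m - 1 :=
        (EdgeEvent.pend_le_max _).trans (max_le
          (pendingLevels_le (fun x y => (hev x y).2.2) l _) (Nat.sub_le_sub_right (hev _ _).2.2 1))
      refine .inr ⟨hp, ?_, Finset.mem_Icc.2 (by omega), le_max_right _ _⟩
      rcases max_choice (e.pend p M (e.chooseReg h p M)) p with h2 | h2
      · rw [h2]
        refine hodd.resolve_left fun h3 => ?_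
        have := hp.pos
        omega
      · rwa [h2]
    · rw [EdgeEvent.choosePrio_even hp]
      exact .inl ⟨Nat.not_odd_iff_even.1 hp, rfl⟩

end Strategy

/-- Without even elements in the index the supremum is `0`, which is even as well. -/
theorem even_reg_init (I : Finset ℕ) (j : ℕ) : Even ((RegConfig.init I).reg j) := by
  refine Finset.sup_induction (p := Even) (Even.zero) (fun a ha b hb => ?_) fun x hx =>
    (Finset.mem_filter.1 hx).2
  rcases max_choice a b with h | h
  · exact h.symm ▸ ha
  · exact h.symm ▸ hb

/-- Zero counters make every load at most `1`, so the levels and counts of the first vertex play no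
role. -/
theorem invariant_init (I : Finset ℕ) (n h d s t : ℕ) (P : ℕ → ℕ) :
    (RegConfig.init I).Invariant n h d s t P (fun _ => 0) where
  mem_above _ _ _ := rfl
  mem_below _ _ hn := absurd rfl hn
  reg_lt ho := absurd (even_reg_init I s) (Nat.not_even_iff_odd.2 ho)
  settled _ x _ _ := ⟨fun _ => Nat.zero_le _,
    fun _ => RegConfig.load_le.trans (by simp [RegConfig.init])⟩
  pending hn := absurd rfl hn

theorem induced_adj_of_consistent {J : Finset ℕ} {W : Set V} (σ : G.Strategy) (hv₀ : v₀ ∈ W)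
    {τ : G.RegStrategy J v₀} (hτ : ∀ l, τ.move l = σ.next (playOf v₀ l)) {ρ : ℕ → RegRound V}
    (hρ : G.IsConsistentRegPlay τ ρ) (k : ℕ) :
    (G.induced σ W).Adj (playOf v₀ (regHistory ρ k)) (playOf v₀ (regHistory ρ (k + 1))) := by
  have step : ∀ k, G.ConsistentHistory σ W (playOf v₀ (regHistory ρ k)) →
      G.ConsistentHistory σ W (playOf v₀ (regHistory ρ (k + 1))) := fun k hk => by
    obtain ⟨past, hp⟩ := exists_playOf_eq (v₀ := v₀) (regHistory ρ k)
    have h1 : playOf v₀ (regHistory ρ (k + 1)) = (ρ k).pos :: playOf v₀ (regHistory ρ k) := rfl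
    obtain ⟨h2, h3, -, -⟩ := hρ k
    rw [hτ, hp] at h3
    rw [hp] at hk
    rw [h1, hp]
    exact .step _ _ _ hk h2 h3
  have all : ∀ k, G.ConsistentHistory σ W (playOf v₀ (regHistory ρ k)) := fun k => by
    induction k with
    | zero => exact .start v₀ hv₀
    | succ k ih => exact step k ih
  exact ⟨all k, all (k + 1), (ρ k).pos, rfl⟩

theorem historyLabel_playOf (l : List (RegRound V)) (w : V) :
    G.historyLabel (playOf v₀ l) (w :: playOf v₀ l) = G.label (currentPos v₀ l) w := by
  obtain ⟨past, hp⟩ := exists_playOf_eq (v₀ := v₀) l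
  rw [hp]
  rfl

end ParityGame

theorem mainTheorem5 {V : Type u} [Countable V] (a b : ℕ) (hab : a ≤ b)
    (G : ParityGame V (Finset.Icc a b)) (W : Set V) (n h : ℕ) (hn : n ≠ 0)
    (hG : G.HasStrahlerNumber W n h) :
    ∀ v ∈ W, G.EveWinsReg (Finset.Icc 1 (2 * h)) (n + 1) v := by
  intro v₀ hv₀
  obtain ⟨σ, -, m, hm, D, hD⟩ := hG
  have hmb : 2 * m ≤ b + 1 := hm.trans
    (Nat.succ_le_succ (Finset.sup_le fun x hx => (Finset.mem_Icc.1 hx).2))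
  have h1 : 1 ≤ h := by
    have := OrdTree.one_le_strahler n D.treeShape
    rw [hD] at this
    exact_mod_cast this
  obtain ⟨ev, t, P, hR⟩ := D.exists_ranking n h hD
  let τ : G.RegStrategy (Finset.Icc 1 (2 * h)) v₀ :=
    ParityGame.regStrategy σ v₀ h1 hmb fun x y => (hR.event x y).2
  refine ⟨τ, fun ρ hρ => ?_⟩
  have hadj := ParityGame.induced_adj_of_consistent σ hv₀ (τ := τ) (fun _ => rfl) hρ
  set π : ℕ → List V := fun k => ParityGame.playOf v₀ (ParityGame.regHistory ρ k) with hπ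
  set M : ℕ → ℕ → ℕ := fun k => G.pendingLevels h ev v₀ (ParityGame.regHistory ρ k) with hM
  have hlabel : ∀ k, (G.induced σ W).label (π k) (π (k + 1)) =
      G.label (ParityGame.currentPos v₀ (ParityGame.regHistory ρ k)) (ρ k).pos := fun k =>
    ParityGame.historyLabel_playOf _ _
  have hreg : ∀ k, (ρ k).reg = (ev (π k) (π (k + 1))).chooseReg h
      ((G.induced σ W).label (π k) (π (k + 1))) (M k) := fun k => by
    rw [hlabel]
    exact (hρ k).2.2.1
  have hprio : ∀ k, (ρ k).prio = (ev (π k) (π (k + 1))).choosePrio h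
      ((G.induced σ W).label (π k) (π (k + 1))) (M k) := fun k => by
    rw [hlabel]
    exact (hρ k).2.2.2
  have hrun : IsRun (n + 1) h (fun k => ev (π k) (π (k + 1)))
      (fun k => (G.induced σ W).label (π k) (π (k + 1)))
      (ParityGame.regConfig (Finset.Icc a b) (n + 1) ρ) M :=
    { config := fun k => by
        rw [← hreg, ← hprio]
        rfl
      memory := fun k => by
        rw [hlabel]
        rfl }
  refine ⟨fun k hk => ?_, ?_⟩
  -- At the root, of number `h`, the invariant holds from the start and protects `r_h`, the only
  -- register whose overflow would leave `[1, 2h]`.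
  · have hI := hrun.invariant_of_ge le_rfl (fun k => hR.vertex (π k)) (K := 0)
      (fun k _ => hR.edge _ _ (hadj k)) (ParityGame.invariant_init _ _ _ _ _ _ _) k (Nat.zero_le k)
    have hle : (ρ k).reg ≤ h := by
      rw [hreg]
      exact EdgeEvent.chooseReg_le (hR.event _ _).2.1
    obtain ⟨hov, hJ⟩ := hk
    rcases hle.eq_or_lt with heq | hlt
    · rw [heq] at hov
      exact hI.not_overflow (hR.vertex _) hov
    · exact hJ (Finset.mem_Icc.2 (by omega))
  -- Acceptance uses the node in which the path ends up, whose number `s` may be smaller than `h`.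
  · obtain ⟨d, s, t', P', hv, he, htop⟩ := hR.path π hadj
    obtain ⟨k, hk⟩ := htop.exists
    have hs : 1 ≤ s ∧ s ≤ h := by
      rw [← hk.2.1]
      exact ⟨(hR.event _ _).1, (hR.event _ _).2.1⟩
    have hacc := hrun.parityAccepting hs.1 hs.2 (fun k => hv (π k)) he htop
    simp only [hreg]
    exact hacc
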